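/- **Theorem (consistency of the inverse optimal control estimator).** Consider $x_{k+1}=Ax_k+Bu_k$ with $A\in\mathbb R^{n\times n}$ invertible, $B\in\mathbb R^{n\times m}$ of full column rank and $(A,B)$ controllable. Let $x_T\in\mathbb R^n$ be the (known) target and $R\in\mathbb R^{m\times m}$ a symmetric positive definite matrix, the true parameter. Let $N_j$, $j=1,2,\dots$, be a bounded sequence of horizons with $N_j\ge 2n$, and let $\bar x^j$ be (deterministic or random) initial positions. The $j$-th trajectory $x^j_0,\dots,x^j_{N_j}$ (in coordinates relative to the target) is generated from $x_0^j=\bar x^j-x_T$ by inputs $u^j_0,\dots,u^j_{N_j-1}$ that minimize $$J=\tfrac12\Big\{x_{N_j}^{\top}x_{N_j}+\sum_{k=0}^{N_j-1}u_k^{\top}Ru_k\Big\}$$ (that is, the terminal weight is normalized to $H=I$). The recorded outputs are $y_0^j=\bar x^j$ and $y_k^j=x_T+x_k^j+\omega_k^j$ for $1\le k\le N_j$, where the noises have mean zero and uniformly bounded second moments $\mathbb E\|\omega_k^j\|^2$, the noise sequences $(\omega_k^j)_k$ of different trajectories $j$ are independent, and all the noises together are independent of the initial positions. Suppose that the true final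 states excite every direction as the number of trajectories grows: almost surely, $$\sum_{j=1}^{\infty}\big(v^{\top}x^j_{N_j}\big)^2=\infty\qquad\text{for every } v\in\mathbb R^n\setminus\{0\}.$$ For $M\ge n$ consider the inverse optimal control problem $$\min_{\hat R,\;x^j_{0:N_j},\;\lambda^j_{0:N_j}}\ \frac1M\sum_{j=1}^M\sum_{i=1}^{N_j}\|y_i^j-x_T-x_i^j\|^2$$ over symmetric positive definite $\hat R$ and vectors $x_i^j,\lambda_i^j\in\mathbb R^n$ subject to $$x_{i+1}^j=Ax_i^j-B\hat R^{-1}B^{\top}\lambda_{i+1}^j,\quad \lambda_i^j=A^{\top}\lambda_{i+1}^j,\quad \lambda^j_{N_j}=x^j_{N_j},\quad x_0^j=y_0^j-x_T,$$ for $0\le i<N_j$, $1\le j\le M$. Let $\hat R_M$ be any matrix-valued function on the probability space that, for almost every outcome for which this problem has an optimal solution, is the $\hat R$-component of an optimal solution. Then $\hat R_M\to R$ in probability as $M\to\infty$. -/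

import Mathlib

open Filter MeasureTheory ProbabilityTheory
open scoped Matrix

-- Matrices carry the Frobenius norm.
attribute [local instance] Matrix.frobeniusNormedAddCommGroup

/-- The controllability matrix `[B, AB, …, Aⁿ⁻¹B]` of the pair `(A, B)`. -/
def controllabilityMatrix {n m : ℕ} (A : Matrix (Fin n) (Fin n) ℝ)
    (B : Matrix (Fin n) (Fin m) ℝ) : Matrix (Fin n) (Fin n × Fin m) ℝ :=
  Matrix.of fun i p => (A ^ (p.1 : ℕ) * B) i p.2

/-- `(A, B)` is controllable: the controllability matrix has rank `n`. -/
def IsControllable {n m : ℕ} (A : Matrix (Fin n) (Fin n) ℝ)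
    (B : Matrix (Fin n) (Fin m) ℝ) : Prop :=
  (controllabilityMatrix A B).rank = n

/-- The states of `x_{k+1} = A x_k + B u_k` from the initial state `x0` under the inputs `u`. -/
def stateTraj {n m : ℕ} (A : Matrix (Fin n) (Fin n) ℝ) (B : Matrix (Fin n) (Fin m) ℝ)
    (x0 : Fin n → ℝ) (u : ℕ → Fin m → ℝ) : ℕ → Fin n → ℝ
  | 0 => x0
  | k + 1 => A *ᵥ stateTraj A B x0 u k + B *ᵥ u k

/-- The quadratic objective `J = ½ (x_Nᵀ H x_N + ∑_{k<N} u_kᵀ R u_k)`. -/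
noncomputable def controlCost {n m : ℕ} (A : Matrix (Fin n) (Fin n) ℝ)
    (B : Matrix (Fin n) (Fin m) ℝ) (H : Matrix (Fin n) (Fin n) ℝ)
    (R : Matrix (Fin m) (Fin m) ℝ) (N : ℕ) (x0 : Fin n → ℝ) (u : ℕ → Fin m → ℝ) : ℝ :=
  (1 / 2) * (stateTraj A B x0 u N ⬝ᵥ (H *ᵥ stateTraj A B x0 u N)
    + ∑ k ∈ Finset.range N, u k ⬝ᵥ (R *ᵥ u k))

/-- `u` (of which only `u 0, …, u (N - 1)` matter) solves the forward control problem. -/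
def IsOptimalControl {n m : ℕ} (A : Matrix (Fin n) (Fin n) ℝ)
    (B : Matrix (Fin n) (Fin m) ℝ) (H : Matrix (Fin n) (Fin n) ℝ)
    (R : Matrix (Fin m) (Fin m) ℝ) (N : ℕ) (x0 : Fin n → ℝ) (u : ℕ → Fin m → ℝ) : Prop :=
  ∀ v : ℕ → Fin m → ℝ, controlCost A B H R N x0 u ≤ controlCost A B H R N x0 v

/-- States `x 0, …, x N` and costates `l 0, …, l N` satisfy the conditions of Pontryagin's minimum
principle with weights `H`, `R`, horizon `N` and initial state `x0`. -/
structure IsPMPTrajectory {n m : ℕ} (A : Matrix (Fin n) (Fin n) ℝ)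
    (B : Matrix (Fin n) (Fin m) ℝ) (H : Matrix (Fin n) (Fin n) ℝ)
    (R : Matrix (Fin m) (Fin m) ℝ) (N : ℕ) (x0 : Fin n → ℝ)
    (x l : ℕ → Fin n → ℝ) : Prop where
  initial : x 0 = x0
  state : ∀ i < N, x (i + 1) = A *ᵥ x i - (B * R⁻¹ * Bᵀ) *ᵥ l (i + 1)
  costate : ∀ i < N, l i = Aᵀ *ᵥ l (i + 1)
  terminal : l N = H *ᵥ x N

/-- The objective `(1/M) ∑_{j<M} ∑_{i=1}^{N_j} ‖y_i^j - x_i^j‖²` of the inverse problem (Euclidean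
norm). The outputs `y j i` are recorded in the original coordinates, the states `x j i` are relative
to the target `xT`. -/
noncomputable def iocCost {n : ℕ} (xT : Fin n → ℝ) (N : ℕ → ℕ) (y x : ℕ → ℕ → Fin n → ℝ)
    (M : ℕ) : ℝ :=
  (1 / (M : ℝ)) * ∑ j ∈ Finset.range M, ∑ i ∈ Finset.Icc 1 (N j),
    (y j i - xT - x j i) ⬝ᵥ (y j i - xT - x j i)

/-- The constraints of the inverse problem for the first `M` trajectories, with terminal
weight `H`. -/
structure IsIOCFeasible {n m : ℕ} (A : Matrix (Fin n) (Fin n) ℝ)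
    (B : Matrix (Fin n) (Fin m) ℝ) (H : Matrix (Fin n) (Fin n) ℝ) (xT : Fin n → ℝ)
    (N : ℕ → ℕ) (y : ℕ → ℕ → Fin n → ℝ) (M : ℕ)
    (R : Matrix (Fin m) (Fin m) ℝ) (x l : ℕ → ℕ → Fin n → ℝ) : Prop where
  posDef : R.PosDef
  pmp : ∀ j < M, IsPMPTrajectory A B H R (N j) (y j 0 - xT) (x j) (l j)

/-- `(R, x, l)` is an optimal solution of the inverse optimal control problem for the first `M`
trajectories, with terminal weight `H`. -/
def IsIOCSolution {n m : ℕ} (A : Matrix (Fin n) (Fin n) ℝ)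
    (B : Matrix (Fin n) (Fin m) ℝ) (H : Matrix (Fin n) (Fin n) ℝ) (xT : Fin n → ℝ)
    (N : ℕ → ℕ) (y : ℕ → ℕ → Fin n → ℝ) (M : ℕ)
    (R : Matrix (Fin m) (Fin m) ℝ) (x l : ℕ → ℕ → Fin n → ℝ) : Prop :=
  IsIOCFeasible A B H xT N y M R x l ∧
    ∀ (R' : Matrix (Fin m) (Fin m) ℝ) (x' l' : ℕ → ℕ → Fin n → ℝ),
      IsIOCFeasible A B H xT N y M R' x' l' → iocCost xT N y x M ≤ iocCost xT N y x' M

/-!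
With terminal weight `1`, the states of a minimum-principle trajectory depend linearly on the
initial state and, through the weight `R`, only on `Q = B R⁻¹ Bᵀ`: `x_i = closedLoop A Q N i x_0`.
An optimal control satisfies the minimum principle, so the recorded states follow this law with the
true `Q₀`, and the inverse problem is the nonlinear least-squares problem of minimizing `fitCost`
over positive definite weights.

The parameter set is not compact and the maps `closedLoop A Q N i` need not be bounded on it, so a
uniform law of large numbers is not at hand. Instead, the problem is embedded in a linear
regression. The predicted states are linear in the initial state, with coefficients depending on
the step and the horizon; as the horizons are bounded, there are finitely many coefficients. A
parameter that fits at least as well as the truth deviates from it, in total square over all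
trajectories (`gapEnergy`), by at most four times the square of the part of the noise that the
regressors explain (`gapEnergy_le_explainedNoise`). The mean of the latter is bounded by the noise
level times the number of coefficients, whatever the number `M` of trajectories
(`integrable_leverage_sum_and_integral_le`). Ridge regularization avoids inverting a singular Gram
matrix, and its parameter is sent to zero by Fatou's lemma (`measure_exists_gapEnergy_gt_le`).
Hence the deviation energy is bounded in probability.

The excitation of the final states, in contrast, tends to infinity, uniformly in the direction by
compactness of the sphere (`tendsto_measure_not_excited`). The relation `Q x_N = A x_{N-1} - x_N`
between the last two states of a trajectory is linear in `Q`. Since it holds for the true and for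
the fitted trajectories, whose total deviation is bounded while the final states are strongly
exciting, it forces `Q` to be close to `Q₀` without any previous bound on `Q`
(`sub_mul_frobenius_norm_sq_le`), and `R` is recovered because `B` has a left inverse. The same
estimate confines all weights that fit at least as well as the truth to a compact set of positive
definite matrices, so that the inverse problem has a solution with probability tending to one
(`exists_posDef_forall_fitCost_le`).
-/

/-! ### Closed-loop maps of the minimum principle -/

/-- The matrix `∑_{k<i} A^{i-1-k} Q (Aᵀ)^{N-1-k}`, where `Q` stands for `B R⁻¹ Bᵀ`. Applied to the
final state of a minimum-principle trajectory of horizon `N`, it gives the displacement that the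
inputs cause in the `i`-th state; for `i = N` it is a weighted reachability Gramian. -/
def reachGramian {n : ℕ} (A Q : Matrix (Fin n) (Fin n) ℝ) (N i : ℕ) :
    Matrix (Fin n) (Fin n) ℝ :=
  ∑ k ∈ Finset.range i, A ^ (i - 1 - k) * Q * Aᵀ ^ (N - 1 - k)

/-- The linear map taking the initial state of a minimum-principle trajectory of horizon `N` to its
`i`-th state, for terminal weight `1` and `Q = B R⁻¹ Bᵀ`. -/
noncomputable def closedLoop {n : ℕ} (A Q : Matrix (Fin n) (Fin n) ℝ) (N i : ℕ) :
    Matrix (Fin n) (Fin n) ℝ :=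
  A ^ i - reachGramian A Q N i * ((1 + reachGramian A Q N N)⁻¹ * A ^ N)

lemma reachGramian_succ {n : ℕ} (A Q : Matrix (Fin n) (Fin n) ℝ) (N i : ℕ) :
    reachGramian A Q N (i + 1) = A * reachGramian A Q N i + Q * Aᵀ ^ (N - 1 - i) := by
  unfold reachGramian
  rw [Finset.sum_range_succ, Finset.mul_sum]
  congr 1
  · refine Finset.sum_congr rfl fun k hk => ?_
    rw [Finset.mem_range] at hk
    rw [show i + 1 - 1 - k = (i - 1 - k) + 1 by omega, pow_succ']
    simp only [Matrix.mul_assoc]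
  · simp

lemma reachGramian_posSemidef {n : ℕ} (A : Matrix (Fin n) (Fin n) ℝ)
    {Q : Matrix (Fin n) (Fin n) ℝ} (hQ : Q.PosSemidef) (N : ℕ) :
    (reachGramian A Q N N).PosSemidef := by
  refine Matrix.posSemidef_sum _ fun k _ => ?_
  have := hQ.mul_mul_conjTranspose_same (A ^ (N - 1 - k))
  rwa [Matrix.conjTranspose_pow, Matrix.conjTranspose_eq_transpose_of_trivial] at this

lemma isUnit_det_one_add_reachGramian {n : ℕ} (A : Matrix (Fin n) (Fin n) ℝ)
    {Q : Matrix (Fin n) (Fin n) ℝ} (hQ : Q.PosSemidef) (N : ℕ) :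
    IsUnit (1 + reachGramian A Q N N).det :=
  (Matrix.isUnit_iff_isUnit_det _).1
    (Matrix.PosDef.one.add_posSemidef (reachGramian_posSemidef A hQ N)).isUnit

lemma closedLoop_zero {n : ℕ} (A Q : Matrix (Fin n) (Fin n) ℝ) (N : ℕ) :
    closedLoop A Q N 0 = 1 := by
  simp [closedLoop, reachGramian]

lemma closedLoop_horizon {n : ℕ} (A : Matrix (Fin n) (Fin n) ℝ)
    {Q : Matrix (Fin n) (Fin n) ℝ} (hQ : Q.PosSemidef) (N : ℕ) :
    closedLoop A Q N N = (1 + reachGramian A Q N N)⁻¹ * A ^ N := by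
  have h := Matrix.mul_nonsing_inv _ (isUnit_det_one_add_reachGramian A hQ N)
  rw [closedLoop, sub_eq_iff_eq_add, ← one_add_mul, ← Matrix.mul_assoc, h, one_mul]

lemma closedLoop_succ {n : ℕ} (A : Matrix (Fin n) (Fin n) ℝ)
    {Q : Matrix (Fin n) (Fin n) ℝ} (hQ : Q.PosSemidef) (N i : ℕ) :
    closedLoop A Q N (i + 1)
      = A * closedLoop A Q N i - Q * Aᵀ ^ (N - 1 - i) * closedLoop A Q N N := by
  rw [closedLoop_horizon A hQ, closedLoop, closedLoop, reachGramian_succ, pow_succ']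
  noncomm_ring

lemma IsPMPTrajectory.costate_eq {n m : ℕ} {A : Matrix (Fin n) (Fin n) ℝ}
    {B : Matrix (Fin n) (Fin m) ℝ} {R : Matrix (Fin m) (Fin m) ℝ} {N : ℕ} {x0 : Fin n → ℝ}
    {x l : ℕ → Fin n → ℝ} (h : IsPMPTrajectory A B 1 R N x0 x l) {i : ℕ} (hi : i ≤ N) :
    l i = Aᵀ ^ (N - i) *ᵥ x N := by
  induction hi using Nat.decreasingInduction with
  | of_succ k hk ih =>
    rw [h.costate k hk, ih, Matrix.mulVec_mulVec, ← pow_succ',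
      show N - (k + 1) + 1 = N - k by omega]
  | self => simp [h.terminal]

/-- The minimum principle determines the states, and they depend linearly on the initial state. -/
lemma IsPMPTrajectory.state_eq {n m : ℕ} {A : Matrix (Fin n) (Fin n) ℝ}
    {B : Matrix (Fin n) (Fin m) ℝ} {R : Matrix (Fin m) (Fin m) ℝ} {N : ℕ} {x0 : Fin n → ℝ}
    {x l : ℕ → Fin n → ℝ} (h : IsPMPTrajectory A B 1 R N x0 x l)
    (hQ : (B * R⁻¹ * Bᵀ).PosSemidef) {i : ℕ} (hi : i ≤ N) :
    x i = closedLoop A (B * R⁻¹ * Bᵀ) N i *ᵥ x0 := by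
  have key : ∀ i ≤ N, x i = A ^ i *ᵥ x0 - reachGramian A (B * R⁻¹ * Bᵀ) N i *ᵥ x N := by
    intro i
    induction i with
    | zero => intro _; simp [reachGramian, h.initial]
    | succ k ih =>
      intro hk
      rw [h.state k (by omega), ih (by omega), h.costate_eq hk, reachGramian_succ,
        Matrix.mulVec_sub, Matrix.mulVec_mulVec, Matrix.mulVec_mulVec, Matrix.mulVec_mulVec,
        Matrix.add_mulVec, pow_succ', show N - (k + 1) = N - 1 - k by omega, sub_sub]
  have hN : (1 + reachGramian A (B * R⁻¹ * Bᵀ) N N) *ᵥ x N = A ^ N *ᵥ x0 := by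
    rw [Matrix.add_mulVec, Matrix.one_mulVec]
    exact eq_sub_iff_add_eq.1 (key N le_rfl)
  have hN' : x N = ((1 + reachGramian A (B * R⁻¹ * Bᵀ) N N)⁻¹ * A ^ N) *ᵥ x0 := by
    rw [← Matrix.mulVec_mulVec, ← hN, Matrix.mulVec_mulVec,
      Matrix.nonsing_inv_mul _ (isUnit_det_one_add_reachGramian A hQ N), Matrix.one_mulVec]
  rw [key i hi, closedLoop, Matrix.sub_mulVec, ← Matrix.mulVec_mulVec, ← hN']

lemma isPMPTrajectory_closedLoop {n m : ℕ} (A : Matrix (Fin n) (Fin n) ℝ)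
    (B : Matrix (Fin n) (Fin m) ℝ) (R : Matrix (Fin m) (Fin m) ℝ) (N : ℕ) (x0 : Fin n → ℝ)
    (hQ : (B * R⁻¹ * Bᵀ).PosSemidef) :
    IsPMPTrajectory A B 1 R N x0 (fun i => closedLoop A (B * R⁻¹ * Bᵀ) N i *ᵥ x0)
      (fun i => Aᵀ ^ (N - i) *ᵥ (closedLoop A (B * R⁻¹ * Bᵀ) N N *ᵥ x0)) where
  initial := by simp [closedLoop_zero]
  state i hi := by
    rw [closedLoop_succ A hQ, show N - (i + 1) = N - 1 - i by omega]
    simp only [Matrix.sub_mulVec, Matrix.mulVec_mulVec, Matrix.mul_assoc]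
  costate i hi := by
    rw [show N - i = N - (i + 1) + 1 by omega, pow_succ', Matrix.mulVec_mulVec,
      Matrix.mulVec_mulVec, Matrix.mulVec_mulVec, Matrix.mul_assoc]
  terminal := by simp

/-! ### Optimal controls satisfy the minimum principle -/

lemma stateTraj_add_smul {n m : ℕ} (A : Matrix (Fin n) (Fin n) ℝ) (B : Matrix (Fin n) (Fin m) ℝ)
    (x0 : Fin n → ℝ) (u w : ℕ → Fin m → ℝ) (t : ℝ) (k : ℕ) :
    stateTraj A B x0 (u + t • w) k = stateTraj A B x0 u k + t • stateTraj A B 0 w k := by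
  induction k with
  | zero => simp [stateTraj]
  | succ k ih =>
    simp only [stateTraj, ih, Pi.add_apply, Pi.smul_apply, Matrix.mulVec_add, Matrix.mulVec_smul,
      smul_add]
    abel

/-- The response to inputs from rest, paired with a final costate `p`. -/
lemma dotProduct_stateTraj_zero {n m : ℕ} (A : Matrix (Fin n) (Fin n) ℝ)
    (B : Matrix (Fin n) (Fin m) ℝ) (w : ℕ → Fin m → ℝ) (N : ℕ) (p : Fin n → ℝ) :
    p ⬝ᵥ stateTraj A B 0 w N
      = ∑ k ∈ Finset.range N, (Bᵀ *ᵥ (Aᵀ ^ (N - 1 - k) *ᵥ p)) ⬝ᵥ w k := by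
  induction N generalizing p with
  | zero => simp [stateTraj]
  | succ N ih =>
    rw [stateTraj, dotProduct_add, Matrix.dotProduct_mulVec, ← Matrix.mulVec_transpose, ih,
      Finset.sum_range_succ, Matrix.dotProduct_mulVec, ← Matrix.mulVec_transpose]
    congr 1
    · refine Finset.sum_congr rfl fun k hk => ?_
      rw [Finset.mem_range] at hk
      rw [Matrix.mulVec_mulVec (M := Aᵀ ^ _), ← pow_succ,
        show N - 1 - k + 1 = N + 1 - 1 - k by omega]
    · simp

/-- A quadratic function of one variable that is nonnegative everywhere and vanishes at `0` has no
linear term. -/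
lemma eq_zero_of_forall_linear_add_sq_nonneg {a b : ℝ} (h : ∀ t : ℝ, 0 ≤ a * t + b * t ^ 2) :
    a = 0 := by
  have hb : 0 ≤ b := by nlinarith [h 1, h (-1)]
  have h1 := h (-a / (2 * (b + 1)))
  have h2 : a * (-a / (2 * (b + 1))) + b * (-a / (2 * (b + 1))) ^ 2
      = -(a ^ 2 * (b + 2)) / (4 * (b + 1) ^ 2) := by
    field_simp
    ring
  rw [h2, le_div_iff₀ (by positivity)] at h1
  nlinarith [mul_nonneg (sq_nonneg a) hb, sq_nonneg a]

/-- The first-order condition of the forward problem: varying the inputs in the direction of the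
gradient shows that `R u_k = -Bᵀ (Aᵀ)^{N-1-k} x_N`. -/
lemma IsOptimalControl.mulVec_eq {n m : ℕ} {A : Matrix (Fin n) (Fin n) ℝ}
    {B : Matrix (Fin n) (Fin m) ℝ} {R : Matrix (Fin m) (Fin m) ℝ} (hR : R.PosDef) {N : ℕ}
    {x0 : Fin n → ℝ} {u : ℕ → Fin m → ℝ} (h : IsOptimalControl A B 1 R N x0 u) {k : ℕ}
    (hk : k < N) :
    R *ᵥ u k = -(Bᵀ *ᵥ (Aᵀ ^ (N - 1 - k) *ᵥ stateTraj A B x0 u N)) := by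
  have hsymm : Rᵀ = R := by
    simpa [Matrix.conjTranspose_eq_transpose_of_trivial] using hR.isHermitian.eq
  set g : ℕ → Fin m → ℝ := fun k =>
    Bᵀ *ᵥ (Aᵀ ^ (N - 1 - k) *ᵥ stateTraj A B x0 u N) + R *ᵥ u k with hg
  have hquad : ∀ t : ℝ, controlCost A B 1 R N x0 (u + t • g) - controlCost A B 1 R N x0 u
      = (∑ k ∈ Finset.range N, g k ⬝ᵥ g k) * t + (1 / 2 * (stateTraj A B 0 g N ⬝ᵥ
        stateTraj A B 0 g N + ∑ k ∈ Finset.range N, g k ⬝ᵥ (R *ᵥ g k))) * t ^ 2 := by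
    intro t
    have h1 : ∑ k ∈ Finset.range N, g k ⬝ᵥ g k = stateTraj A B x0 u N ⬝ᵥ stateTraj A B 0 g N
        + ∑ k ∈ Finset.range N, g k ⬝ᵥ (R *ᵥ u k) := by
      rw [dotProduct_stateTraj_zero, ← Finset.sum_add_distrib]
      refine Finset.sum_congr rfl fun k _ => ?_
      rw [dotProduct_comm (g k) (R *ᵥ u k), ← add_dotProduct]
    have h2 : ∀ k, (u + t • g) k ⬝ᵥ (R *ᵥ (u + t • g) k)
        = u k ⬝ᵥ (R *ᵥ u k) + 2 * t * (g k ⬝ᵥ (R *ᵥ u k)) + t ^ 2 * (g k ⬝ᵥ (R *ᵥ g k)) := by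
      intro k
      have h3 : u k ⬝ᵥ (R *ᵥ g k) = g k ⬝ᵥ (R *ᵥ u k) := by
        rw [Matrix.dotProduct_mulVec, ← Matrix.mulVec_transpose, hsymm, dotProduct_comm]
      simp only [Pi.add_apply, Pi.smul_apply, Matrix.mulVec_add, Matrix.mulVec_smul,
        add_dotProduct, dotProduct_add, smul_dotProduct, dotProduct_smul, smul_eq_mul, h3]
      ring
    unfold controlCost
    simp only [stateTraj_add_smul, h2, Matrix.one_mulVec, Finset.sum_add_distrib,
      ← Finset.mul_sum, add_dotProduct, dotProduct_add, smul_dotProduct, dotProduct_smul,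
      smul_eq_mul, h1]
    rw [dotProduct_comm (stateTraj A B 0 g N) (stateTraj A B x0 u N)]
    ring
  have hsum : ∑ k ∈ Finset.range N, g k ⬝ᵥ g k = 0 :=
    eq_zero_of_forall_linear_add_sq_nonneg fun t => by
      rw [← hquad]
      exact sub_nonneg.2 (h _)
  have hgk := (Finset.sum_eq_zero_iff_of_nonneg fun k _ =>
    Finset.sum_nonneg fun i _ => mul_self_nonneg (g k i)).1 hsum k (Finset.mem_range.2 hk)
  exact eq_neg_of_add_eq_zero_right (dotProduct_self_eq_zero.1 hgk)

lemma IsOptimalControl.isPMPTrajectory {n m : ℕ} {A : Matrix (Fin n) (Fin n) ℝ}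
    {B : Matrix (Fin n) (Fin m) ℝ} {R : Matrix (Fin m) (Fin m) ℝ} (hR : R.PosDef) {N : ℕ}
    {x0 : Fin n → ℝ} {u : ℕ → Fin m → ℝ} (h : IsOptimalControl A B 1 R N x0 u) :
    IsPMPTrajectory A B 1 R N x0 (stateTraj A B x0 u)
      (fun i => Aᵀ ^ (N - i) *ᵥ stateTraj A B x0 u N) where
  initial := rfl
  state i hi := by
    have h1 : u i = R⁻¹ *ᵥ (R *ᵥ u i) := by
      rw [Matrix.mulVec_mulVec, Matrix.nonsing_inv_mul _
        ((Matrix.isUnit_iff_isUnit_det _).1 hR.isUnit), Matrix.one_mulVec]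
    rw [stateTraj, h1, h.mulVec_eq hR hi, show N - (i + 1) = N - 1 - i by omega]
    simp only [Matrix.mulVec_neg, Matrix.mulVec_mulVec, Matrix.mul_assoc, ← sub_eq_add_neg]
  costate i hi := by
    rw [show N - i = N - (i + 1) + 1 by omega, pow_succ', Matrix.mulVec_mulVec]
  terminal := by simp

lemma posSemidef_mul_inv_mul_transpose {n m : ℕ} (B : Matrix (Fin n) (Fin m) ℝ)
    {R : Matrix (Fin m) (Fin m) ℝ} (hR : R.PosDef) : (B * R⁻¹ * Bᵀ).PosSemidef := by
  have := hR.inv.posSemidef.mul_mul_conjTranspose_same B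
  rwa [Matrix.conjTranspose_eq_transpose_of_trivial] at this

/-! ### Ridge regression -/

/-- The regularized Gram matrix `ε + ∑_{j∈J} φ_j φ_jᵀ` of the regressors `φ_j`. -/
noncomputable def ridgeGram {ι : Type*} [DecidableEq ι] (φ : ℕ → ι → ℝ) (J : Finset ℕ) (ε : ℝ) :
    Matrix ι ι ℝ :=
  ε • 1 + ∑ j ∈ J, Matrix.vecMulVec (φ j) (φ j)

/-- The entries `φ_jᵀ (ε + ∑ φ φᵀ)⁻¹ φ_k` of the hat matrix of ridge regression. -/
noncomputable def leverage {ι : Type*} [Fintype ι] [DecidableEq ι] (φ : ℕ → ι → ℝ) (J : Finset ℕ)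
    (ε : ℝ) (j k : ℕ) : ℝ :=
  φ j ⬝ᵥ ((ridgeGram φ J ε)⁻¹ *ᵥ φ k)

lemma ridgeGram_posDef {ι : Type*} [Fintype ι] [DecidableEq ι] (φ : ℕ → ι → ℝ) (J : Finset ℕ)
    {ε : ℝ} (hε : 0 < ε) : (ridgeGram φ J ε).PosDef := by
  refine Matrix.PosDef.add_posSemidef (Matrix.PosDef.one.smul hε) ?_
  refine Matrix.posSemidef_sum _ fun j _ => ?_
  have := Matrix.posSemidef_vecMulVec_self_star (φ j)
  rwa [star_trivial] at this

lemma isUnit_det_ridgeGram {ι : Type*} [Fintype ι] [DecidableEq ι] (φ : ℕ → ι → ℝ)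
    (J : Finset ℕ) {ε : ℝ} (hε : 0 < ε) : IsUnit (ridgeGram φ J ε).det :=
  (Matrix.isUnit_iff_isUnit_det _).1 (ridgeGram_posDef φ J hε).isUnit

lemma ridgeGram_mulVec {ι : Type*} [Fintype ι] [DecidableEq ι] (φ : ℕ → ι → ℝ) (J : Finset ℕ)
    (ε : ℝ) (θ : ι → ℝ) :
    ridgeGram φ J ε *ᵥ θ = ε • θ + ∑ j ∈ J, (φ j ⬝ᵥ θ) • φ j := by
  rw [ridgeGram, Matrix.add_mulVec, Matrix.smul_mulVec, Matrix.one_mulVec, Matrix.sum_mulVec]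
  simp [Matrix.vecMulVec_mulVec]

lemma dotProduct_ridgeGram_mulVec {ι : Type*} [Fintype ι] [DecidableEq ι] (φ : ℕ → ι → ℝ)
    (J : Finset ℕ) (ε : ℝ) (θ : ι → ℝ) :
    θ ⬝ᵥ (ridgeGram φ J ε *ᵥ θ) = ε * (θ ⬝ᵥ θ) + ∑ j ∈ J, (θ ⬝ᵥ φ j) ^ 2 := by
  rw [ridgeGram_mulVec, dotProduct_add, dotProduct_smul, dotProduct_sum, smul_eq_mul]
  congr 1
  refine Finset.sum_congr rfl fun j _ => ?_
  rw [dotProduct_smul, smul_eq_mul, dotProduct_comm (φ j), sq]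

lemma leverage_comm {ι : Type*} [Fintype ι] [DecidableEq ι] (φ : ℕ → ι → ℝ) (J : Finset ℕ)
    {ε : ℝ} (hε : 0 < ε) (j k : ℕ) : leverage φ J ε j k = leverage φ J ε k j := by
  have h : ((ridgeGram φ J ε)⁻¹)ᵀ = (ridgeGram φ J ε)⁻¹ := by
    simpa [Matrix.conjTranspose_eq_transpose_of_trivial] using
      (ridgeGram_posDef φ J hε).inv.isHermitian.eq
  rw [leverage, leverage, Matrix.dotProduct_mulVec, ← Matrix.mulVec_transpose, h, dotProduct_comm]

lemma inv_ridgeGram_nonneg {ι : Type*} [Fintype ι] [DecidableEq ι] (φ : ℕ → ι → ℝ)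
    (J : Finset ℕ) {ε : ℝ} (hε : 0 < ε) (v : ι → ℝ) :
    0 ≤ v ⬝ᵥ ((ridgeGram φ J ε)⁻¹ *ᵥ v) := by
  simpa using (ridgeGram_posDef φ J hε).inv.posSemidef.dotProduct_mulVec_nonneg v

lemma leverage_self_nonneg {ι : Type*} [Fintype ι] [DecidableEq ι] (φ : ℕ → ι → ℝ)
    (J : Finset ℕ) {ε : ℝ} (hε : 0 < ε) (j : ℕ) : 0 ≤ leverage φ J ε j j :=
  inv_ridgeGram_nonneg φ J hε _

/-- The leverages sum up to `tr (1 - ε (ε + ∑ φ φᵀ)⁻¹)`, at most the number of parameters. -/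
lemma sum_leverage_self_le {ι : Type*} [Fintype ι] [DecidableEq ι] (φ : ℕ → ι → ℝ)
    (J : Finset ℕ) {ε : ℝ} (hε : 0 < ε) :
    ∑ j ∈ J, leverage φ J ε j j ≤ Fintype.card ι := by
  have h1 : ∑ j ∈ J, leverage φ J ε j j
      = ((ridgeGram φ J ε)⁻¹ * ∑ j ∈ J, Matrix.vecMulVec (φ j) (φ j)).trace := by
    rw [Finset.mul_sum, Matrix.trace_sum]
    refine Finset.sum_congr rfl fun j _ => ?_
    rw [Matrix.mul_vecMulVec, Matrix.trace_vecMulVec, dotProduct_comm, leverage]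
  have h2 : ∑ j ∈ J, Matrix.vecMulVec (φ j) (φ j) = ridgeGram φ J ε - ε • 1 := by
    rw [ridgeGram, add_sub_cancel_left]
  have h3 := (ridgeGram_posDef φ J hε).inv.posSemidef.trace_nonneg
  rw [h1, h2, mul_sub, Matrix.nonsing_inv_mul _ (isUnit_det_ridgeGram φ J hε), Matrix.trace_sub,
    Matrix.trace_one, Matrix.mul_smul, mul_one, Matrix.trace_smul, smul_eq_mul]
  nlinarith

lemma abs_leverage_le {ι : Type*} [Fintype ι] [DecidableEq ι] (φ : ℕ → ι → ℝ)
    (J : Finset ℕ) {ε : ℝ} (hε : 0 < ε) {j k : ℕ} (hj : j ∈ J) (hk : k ∈ J) :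
    |leverage φ J ε j k| ≤ Fintype.card ι := by
  have hle : ∀ i ∈ J, leverage φ J ε i i ≤ Fintype.card ι := fun i hi =>
    (Finset.single_le_sum (f := fun i => leverage φ J ε i i)
      (fun i _ => leverage_self_nonneg φ J hε i) hi).trans (sum_leverage_self_le φ J hε)
  have hadd := inv_ridgeGram_nonneg φ J hε (φ j + φ k)
  have hsub := inv_ridgeGram_nonneg φ J hε (φ j - φ k)
  have hc := leverage_comm φ J hε j k
  have hj' := hle j hj
  have hk' := hle k hk
  simp only [Matrix.mulVec_add, Matrix.mulVec_sub, dotProduct_add, dotProduct_sub,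
    add_dotProduct, sub_dotProduct, ← leverage.eq_1] at hadd hsub
  rw [abs_le]
  constructor <;> linarith

/-- The correlation of any linear predictor `θ ⬝ φ_j` with the noise `w` is controlled by its size
and by the part of the noise that the regressors can explain. -/
lemma two_mul_sum_mul_predictor_le {ι : Type*} [Fintype ι] [DecidableEq ι] (φ : ℕ → ι → ℝ)
    (J : Finset ℕ) {ε : ℝ} (hε : 0 < ε) (w : ℕ → ℝ) (θ : ι → ℝ) :
    2 * ∑ j ∈ J, w j * (θ ⬝ᵥ φ j)
      ≤ 1 / 2 * (ε * (θ ⬝ᵥ θ) + ∑ j ∈ J, (θ ⬝ᵥ φ j) ^ 2)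
        + 2 * ∑ j ∈ J, ∑ k ∈ J, leverage φ J ε j k * (w j * w k) := by
  set S := ridgeGram φ J ε with hS
  set z : ι → ℝ := ∑ j ∈ J, w j • φ j with hz
  set v : ι → ℝ := S⁻¹ *ᵥ z with hv
  have hSv : S *ᵥ v = z := by
    rw [hv, Matrix.mulVec_mulVec, Matrix.mul_nonsing_inv _ (isUnit_det_ridgeGram φ J hε),
      Matrix.one_mulVec]
  have hsymm : Sᵀ = S := by
    simpa [Matrix.conjTranspose_eq_transpose_of_trivial] using
      (ridgeGram_posDef φ J hε).isHermitian.eq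
  -- complete the square in `θ`
  have hpos : 0 ≤ (θ - (2 : ℝ) • v) ⬝ᵥ (S *ᵥ (θ - (2 : ℝ) • v)) := by
    simpa using (ridgeGram_posDef φ J hε).posSemidef.dotProduct_mulVec_nonneg (θ - (2 : ℝ) • v)
  have h1 : v ⬝ᵥ (S *ᵥ θ) = θ ⬝ᵥ z := by
    rw [Matrix.dotProduct_mulVec, ← Matrix.mulVec_transpose, hsymm, hSv, dotProduct_comm]
  have h2 : θ ⬝ᵥ z = ∑ j ∈ J, w j * (θ ⬝ᵥ φ j) := by
    rw [hz, dotProduct_sum]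
    exact Finset.sum_congr rfl fun j _ => by rw [dotProduct_smul, smul_eq_mul]
  have h3 : v ⬝ᵥ z = ∑ j ∈ J, ∑ k ∈ J, leverage φ J ε j k * (w j * w k) := by
    rw [dotProduct_comm, hv, hz, Matrix.mulVec_sum, sum_dotProduct]
    refine Finset.sum_congr rfl fun j _ => ?_
    rw [dotProduct_sum]
    refine Finset.sum_congr rfl fun k _ => ?_
    rw [Matrix.mulVec_smul, smul_dotProduct, dotProduct_smul, leverage, smul_eq_mul, smul_eq_mul]
    ring
  rw [Matrix.mulVec_sub, Matrix.mulVec_smul, hSv, sub_dotProduct, dotProduct_sub, dotProduct_sub,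
    dotProduct_smul, smul_dotProduct, smul_dotProduct, dotProduct_smul, h1, h3,
    hS, dotProduct_ridgeGram_mulVec] at hpos
  simp only [smul_eq_mul] at hpos
  rw [← h2]
  linarith

lemma continuous_leverage {ι : Type*} [Fintype ι] [DecidableEq ι] (J : Finset ℕ) {ε : ℝ}
    (hε : 0 < ε) (j k : ℕ) : Continuous fun φ : ℕ → ι → ℝ => leverage φ J ε j k := by
  have hG : Continuous fun φ : ℕ → ι → ℝ => ridgeGram φ J ε := by
    unfold ridgeGram
    refine continuous_const.add (continuous_finsetSum _ fun i _ => ?_)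
    exact (continuous_apply i).matrix_vecMulVec (continuous_apply i)
  have hinv : Continuous fun φ : ℕ → ι → ℝ => (ridgeGram φ J ε)⁻¹ := by
    refine continuous_iff_continuousAt.2 fun φ => ?_
    refine ContinuousAt.comp (g := Inv.inv) (continuousAt_matrix_inv _ ?_) hG.continuousAt
    rw [Ring.inverse_eq_inv']
    exact continuousAt_inv₀ (isUnit_det_ridgeGram φ J hε).ne_zero
  exact (continuous_apply j).dotProduct (hinv.matrix_mulVec (continuous_apply k))

/-- If the noise is uncorrelated, has mean square at most `σ`, and is independent of the regressors,
then the expected squared size of the part of it that the regressors explain is at most `σ` times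
the number of parameters, however many observations there are. -/
lemma integrable_leverage_sum_and_integral_le {ι : Type*} [Fintype ι] [DecidableEq ι]
    {Ω : Type*} [MeasurableSpace Ω] {μ : Measure Ω} [IsProbabilityMeasure μ]
    {E : Type*} [MeasurableSpace E] {X : Ω → E} (hX : Measurable X)
    {φ : E → ℕ → ι → ℝ} (hφ : Measurable φ) {w : ℕ → Ω → ℝ} (hw : ∀ j, MemLp (w j) 2 μ)
    {σ : ℝ} (hσ : ∀ j, ∫ ω, w j ω * w j ω ∂μ ≤ σ)
    (horth : ∀ j k, j ≠ k → ∫ ω, w j ω * w k ω ∂μ = 0)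
    (hind : ∀ j k, IndepFun X (fun ω => w j ω * w k ω) μ) (J : Finset ℕ) {ε : ℝ} (hε : 0 < ε) :
    Integrable (fun ω => ∑ j ∈ J, ∑ k ∈ J, leverage (φ (X ω)) J ε j k * (w j ω * w k ω)) μ ∧
    ∫ ω, ∑ j ∈ J, ∑ k ∈ J, leverage (φ (X ω)) J ε j k * (w j ω * w k ω) ∂μ
      ≤ σ * Fintype.card ι := by
  have hlm : ∀ j k, Measurable fun x => leverage (φ x) J ε j k := fun j k =>
    (continuous_leverage J hε j k).measurable.comp hφ
  have hww : ∀ j k, Integrable (fun ω => w j ω * w k ω) μ := fun j k =>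
    (hw j).integrable_mul (hw k)
  have hint : ∀ j ∈ J, ∀ k ∈ J,
      Integrable (fun ω => leverage (φ (X ω)) J ε j k * (w j ω * w k ω)) μ := fun j hj k hk =>
    (hww j k).bdd_mul (c := Fintype.card ι) ((hlm j k).comp hX).aestronglyMeasurable
      (Eventually.of_forall fun ω => abs_leverage_le _ J hε hj hk)
  have hprod : ∀ j k, ∫ ω, leverage (φ (X ω)) J ε j k * (w j ω * w k ω) ∂μ
      = (∫ ω, leverage (φ (X ω)) J ε j k ∂μ) * ∫ ω, w j ω * w k ω ∂μ := fun j k =>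
    ((hind j k).comp (hlm j k) measurable_id).integral_fun_mul_eq_mul_integral
      ((hlm j k).comp hX).aestronglyMeasurable (hww j k).aestronglyMeasurable
  have hlint : ∀ j ∈ J, Integrable (fun ω => leverage (φ (X ω)) J ε j j) μ := fun j hj =>
    Integrable.of_bound ((hlm j j).comp hX).aestronglyMeasurable (Fintype.card ι)
      (Eventually.of_forall fun ω => abs_leverage_le _ J hε hj hj)
  have hσ0 : 0 ≤ σ := (integral_nonneg fun ω => mul_self_nonneg (w 0 ω)).trans (hσ 0)
  refine ⟨integrable_finsetSum _ fun j hj => integrable_finsetSum _ fun k hk =>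
    hint j hj k hk, ?_⟩
  rw [integral_finsetSum _ fun j hj => integrable_finsetSum _ fun k hk => hint j hj k hk]
  calc ∑ j ∈ J, ∫ ω, ∑ k ∈ J, leverage (φ (X ω)) J ε j k * (w j ω * w k ω) ∂μ
      = ∑ j ∈ J, (∫ ω, leverage (φ (X ω)) J ε j j ∂μ) * ∫ ω, w j ω * w j ω ∂μ := by
        refine Finset.sum_congr rfl fun j hj => ?_
        rw [integral_finsetSum _ fun k hk => hint j hj k hk,
          Finset.sum_eq_single_of_mem j hj fun k _ hkj => ?_, hprod]
        rw [hprod, horth j k hkj.symm, mul_zero]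
    _ ≤ ∑ j ∈ J, (∫ ω, leverage (φ (X ω)) J ε j j ∂μ) * σ := by
        refine Finset.sum_le_sum fun j _ => mul_le_mul_of_nonneg_left (hσ j) ?_
        exact integral_nonneg fun ω => leverage_self_nonneg _ J hε j
    _ = σ * ∫ ω, ∑ j ∈ J, leverage (φ (X ω)) J ε j j ∂μ := by
        rw [← Finset.sum_mul, integral_finsetSum _ hlint, mul_comm]
    _ ≤ σ * Fintype.card ι := by
        refine mul_le_mul_of_nonneg_left ?_ hσ0
        calc ∫ ω, ∑ j ∈ J, leverage (φ (X ω)) J ε j j ∂μ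
            ≤ ∫ _, (Fintype.card ι : ℝ) ∂μ :=
              integral_mono (integrable_finsetSum _ hlint) (integrable_const _)
                fun ω => sum_leverage_self_le _ J hε
          _ = Fintype.card ι := by simp

/-! ### Identification from an excited linear relation -/

lemma frobenius_norm_sq {m n : ℕ} (A : Matrix (Fin m) (Fin n) ℝ) :
    ‖A‖ ^ 2 = ∑ i, A i ⬝ᵥ A i := by
  have h : 0 ≤ ∑ i, ∑ j, ‖A i j‖ ^ (2 : ℝ) := by positivity
  rw [Matrix.frobenius_norm_def, ← Real.sqrt_eq_rpow, Real.sq_sqrt h]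
  refine Finset.sum_congr rfl fun i _ => Finset.sum_congr rfl fun j _ => ?_
  rw [Real.rpow_two, Real.norm_eq_abs, sq_abs, sq]

lemma dotProduct_self_nonneg_real {n : ℕ} (v : Fin n → ℝ) : 0 ≤ v ⬝ᵥ v :=
  Finset.sum_nonneg fun i _ => mul_self_nonneg (v i)

lemma mulVec_dotProduct_self_le {m n : ℕ} (A : Matrix (Fin m) (Fin n) ℝ) (v : Fin n → ℝ) :
    (A *ᵥ v) ⬝ᵥ (A *ᵥ v) ≤ ‖A‖ ^ 2 * (v ⬝ᵥ v) := by
  rw [frobenius_norm_sq, Finset.sum_mul]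
  refine Finset.sum_le_sum fun i _ => ?_
  have := Finset.sum_mul_sq_le_sq_mul_sq Finset.univ (A i) v
  simpa only [Matrix.mulVec, dotProduct, sq] using this

lemma add_dotProduct_self_le {n : ℕ} (a b : Fin n → ℝ) :
    (a + b) ⬝ᵥ (a + b) ≤ 2 * (a ⬝ᵥ a) + 2 * (b ⬝ᵥ b) := by
  have := dotProduct_self_nonneg_real (a - b)
  simp only [add_dotProduct, dotProduct_add, sub_dotProduct, dotProduct_sub] at this ⊢
  linarith

lemma mul_frobenius_norm_sq_le_of_excited {n : ℕ} (D : Matrix (Fin n) (Fin n) ℝ) {c : ℝ}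
    (J : Finset ℕ) (x : ℕ → Fin n → ℝ)
    (hexc : ∀ v : Fin n → ℝ, c * (v ⬝ᵥ v) ≤ ∑ j ∈ J, (v ⬝ᵥ x j) ^ 2) :
    c * ‖D‖ ^ 2 ≤ ∑ j ∈ J, (D *ᵥ x j) ⬝ᵥ (D *ᵥ x j) := by
  have h : ∑ j ∈ J, (D *ᵥ x j) ⬝ᵥ (D *ᵥ x j) = ∑ i, ∑ j ∈ J, (D i ⬝ᵥ x j) ^ 2 := by
    rw [Finset.sum_comm]
    exact Finset.sum_congr rfl fun j _ => Finset.sum_congr rfl fun i _ => by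
      rw [sq]; rfl
  rw [h, frobenius_norm_sq, Finset.mul_sum]
  exact Finset.sum_le_sum fun i _ => hexc (D i)

/-- If `K (x_j + e_j) = K₀ x_j - (e_j - A f_j)` for all `j`, where the `x_j` excite every direction
with strength `c` while the perturbations `e_j`, `f_j` have total square at most `d`, then `K` is
close to `K₀` once `c` is large compared with `d`. No bound on `K` is needed beforehand. -/
lemma sub_mul_frobenius_norm_sq_le {n : ℕ} (A K K₀ : Matrix (Fin n) (Fin n) ℝ) {c d : ℝ}
    (J : Finset ℕ) (x e f : ℕ → Fin n → ℝ)
    (hexc : ∀ v : Fin n → ℝ, c * (v ⬝ᵥ v) ≤ ∑ j ∈ J, (v ⬝ᵥ x j) ^ 2)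
    (hrel : ∀ j ∈ J, K *ᵥ (x j + e j) = K₀ *ᵥ x j - (e j - A *ᵥ f j))
    (hd : ∑ j ∈ J, (e j ⬝ᵥ e j + f j ⬝ᵥ f j) ≤ d) :
    (c - 2 * d) * ‖K - K₀‖ ^ 2 ≤ 4 * (‖K₀ + 1‖ ^ 2 + ‖A‖ ^ 2) * d := by
  have hterm : ∀ j ∈ J, ((K - K₀) *ᵥ x j) ⬝ᵥ ((K - K₀) *ᵥ x j)
      ≤ (2 * ‖K - K₀‖ ^ 2 + 4 * (‖K₀ + 1‖ ^ 2 + ‖A‖ ^ 2)) * (e j ⬝ᵥ e j + f j ⬝ᵥ f j) := by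
    intro j hj
    have h1 : (K - K₀) *ᵥ x j
        = -((K - K₀) *ᵥ e j + ((K₀ + 1) *ᵥ e j + (-A) *ᵥ f j)) := by
      have h := hrel j hj
      rw [Matrix.mulVec_add] at h
      rw [Matrix.sub_mulVec, eq_sub_of_add_eq h]
      simp only [Matrix.sub_mulVec, Matrix.add_mulVec, Matrix.one_mulVec, Matrix.neg_mulVec]
      abel
    have ha := add_dotProduct_self_le ((K - K₀) *ᵥ e j) ((K₀ + 1) *ᵥ e j + (-A) *ᵥ f j)
    have hb := add_dotProduct_self_le ((K₀ + 1) *ᵥ e j) ((-A) *ᵥ f j)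
    have h2 := mulVec_dotProduct_self_le (K - K₀) (e j)
    have h3 := mulVec_dotProduct_self_le (K₀ + 1) (e j)
    have h4 := mulVec_dotProduct_self_le (-A) (f j)
    rw [norm_neg] at h4
    have he := dotProduct_self_nonneg_real (e j)
    have hf := dotProduct_self_nonneg_real (f j)
    rw [h1, neg_dotProduct_neg]
    nlinarith [mul_nonneg (sq_nonneg ‖K - K₀‖) hf, mul_nonneg (sq_nonneg ‖K₀ + 1‖) hf,
      mul_nonneg (sq_nonneg ‖A‖) he]
  have h1 := (mul_frobenius_norm_sq_le_of_excited (K - K₀) J x hexc).trans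
    (Finset.sum_le_sum hterm)
  rw [← Finset.mul_sum] at h1
  have h2 := h1.trans (mul_le_mul_of_nonneg_left hd (by positivity))
  linarith

lemma exists_mul_eq_one_of_rank_eq {n m : ℕ} (B : Matrix (Fin n) (Fin m) ℝ) (hB : B.rank = m) :
    ∃ L : Matrix (Fin m) (Fin n) ℝ, L * B = 1 := by
  have hker : LinearMap.ker B.mulVecLin = ⊥ := by
    have h := LinearMap.finrank_range_add_finrank_ker B.mulVecLin
    rw [← Matrix.rank, hB, Module.finrank_fin_fun] at h
    exact Submodule.finrank_eq_zero.1 (by omega)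
  obtain ⟨g, hg⟩ := LinearMap.exists_leftInverse_of_injective _ hker
  refine ⟨LinearMap.toMatrix' g, ?_⟩
  have h := congrArg LinearMap.toMatrix' hg
  rwa [LinearMap.toMatrix'_comp, LinearMap.toMatrix'_id, ← Matrix.toLin'_apply',
    LinearMap.toMatrix'_toLin'] at h

/-- Two weights `P`, `P₀` are as close as `B P Bᵀ` and `B P₀ Bᵀ`, up to a factor
given by a left inverse of `B`. -/
lemma norm_sub_le_of_mul_eq_one {n m : ℕ} {B : Matrix (Fin n) (Fin m) ℝ}
    {L : Matrix (Fin m) (Fin n) ℝ} (hL : L * B = 1) (P P₀ : Matrix (Fin m) (Fin m) ℝ) :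
    ‖P - P₀‖ ≤ ‖L‖ * ‖B * P * Bᵀ - B * P₀ * Bᵀ‖ * ‖Lᵀ‖ := by
  have h : P - P₀ = L * (B * P * Bᵀ - B * P₀ * Bᵀ) * Lᵀ := by
    have h1 : Bᵀ * Lᵀ = 1 := by rw [← Matrix.transpose_mul, hL, Matrix.transpose_one]
    have h2 : ∀ P : Matrix (Fin m) (Fin m) ℝ, L * (B * P * Bᵀ) * Lᵀ = P := fun P => by
      calc L * (B * P * Bᵀ) * Lᵀ = (L * B) * P * (Bᵀ * Lᵀ) := by simp only [Matrix.mul_assoc]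
        _ = P := by rw [hL, h1, one_mul, mul_one]
    rw [Matrix.mul_sub, Matrix.sub_mul, h2, h2]
  calc ‖P - P₀‖ = ‖L * (B * P * Bᵀ - B * P₀ * Bᵀ) * Lᵀ‖ := by rw [← h]
    _ ≤ ‖L * (B * P * Bᵀ - B * P₀ * Bᵀ)‖ * ‖Lᵀ‖ := Matrix.frobenius_norm_mul _ _
    _ ≤ _ := mul_le_mul_of_nonneg_right (Matrix.frobenius_norm_mul _ _) (norm_nonneg _)

/-! ### Uniform excitation -/

/-- If the sums `∑_{j<M} (v ⬝ x_j)²` diverge for each direction `v ≠ 0`, they do so uniformly over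
the directions, by compactness of the sphere. -/
lemma exists_forall_excited {n : ℕ} (x : ℕ → Fin n → ℝ)
    (h : ∀ v : Fin n → ℝ, v ≠ 0 →
      Tendsto (fun M : ℕ => ∑ j ∈ Finset.range M, (v ⬝ᵥ x j) ^ 2) atTop atTop) (c : ℝ) :
    ∃ M : ℕ, ∀ v : Fin n → ℝ, c * (v ⬝ᵥ v) ≤ ∑ j ∈ Finset.range M, (v ⬝ᵥ x j) ^ 2 := by
  set U : ℕ → Set (Fin n → ℝ) := fun M =>
    {v | c * (v ⬝ᵥ v) < ∑ j ∈ Finset.range M, (v ⬝ᵥ x j) ^ 2} with hU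
  have hopen : ∀ M, IsOpen (U M) := fun M =>
    isOpen_lt (by simp only [dotProduct]; fun_prop) (by simp only [dotProduct]; fun_prop)
  have hcover : Metric.sphere (0 : Fin n → ℝ) 1 ⊆ ⋃ M, U M := by
    intro v hv
    have hv0 : v ≠ 0 := by
      rintro rfl
      simp at hv
    obtain ⟨M, hM⟩ := ((h v hv0).eventually_gt_atTop (c * (v ⬝ᵥ v))).exists
    exact Set.mem_iUnion.2 ⟨M, hM⟩
  have hmono : Monotone U := by
    intro M M' hMM' v hv
    simp only [hU, Set.mem_ofPred_eq] at hv ⊢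
    exact hv.trans_le (Finset.sum_le_sum_of_subset_of_nonneg
      (Finset.range_subset_range.2 hMM') fun _ _ _ => sq_nonneg _)
  obtain ⟨M, hM⟩ := (isCompact_sphere (0 : Fin n → ℝ) 1).elim_directed_cover U hopen hcover
    hmono.directed_le
  refine ⟨M, fun v => ?_⟩
  rcases eq_or_ne v 0 with rfl | hv
  · simp
  have hv' : ‖v‖ ≠ 0 := norm_ne_zero_iff.2 hv
  have hmem : ‖v‖⁻¹ • v ∈ Metric.sphere (0 : Fin n → ℝ) 1 := by
    rw [mem_sphere_zero_iff_norm, norm_smul, norm_inv, norm_norm, inv_mul_cancel₀ hv']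
  have h1 : c * ((‖v‖⁻¹ • v) ⬝ᵥ (‖v‖⁻¹ • v))
      ≤ ∑ j ∈ Finset.range M, ((‖v‖⁻¹ • v) ⬝ᵥ x j) ^ 2 := (hM hmem).le
  simp only [smul_dotProduct, dotProduct_smul, smul_eq_mul, mul_pow, ← Finset.mul_sum] at h1
  have h2 : 0 < ‖v‖⁻¹ ^ 2 := by positivity
  exact le_of_mul_le_mul_left (by linarith) h2

lemma measurableSet_excited {n : ℕ} {Ω : Type*} [MeasurableSpace Ω] {X : ℕ → Ω → Fin n → ℝ}
    (hX : ∀ j, Measurable (X j)) (c : ℝ) (M : ℕ) :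
    MeasurableSet {ω | ∀ v : Fin n → ℝ,
      c * (v ⬝ᵥ v) ≤ ∑ j ∈ Finset.range M, (v ⬝ᵥ X j ω) ^ 2} := by
  have h : {ω | ∀ v : Fin n → ℝ, c * (v ⬝ᵥ v) ≤ ∑ j ∈ Finset.range M, (v ⬝ᵥ X j ω) ^ 2}
      = ⋂ k : ℕ, {ω | c * (TopologicalSpace.denseSeq (Fin n → ℝ) k ⬝ᵥ
          TopologicalSpace.denseSeq (Fin n → ℝ) k)
        ≤ ∑ j ∈ Finset.range M, (TopologicalSpace.denseSeq (Fin n → ℝ) k ⬝ᵥ X j ω) ^ 2} := by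
    ext ω
    simp only [Set.mem_ofPred_eq, Set.mem_iInter]
    refine ⟨fun h k => h _, fun h v => ?_⟩
    have hcl : IsClosed {v : Fin n → ℝ |
        c * (v ⬝ᵥ v) ≤ ∑ j ∈ Finset.range M, (v ⬝ᵥ X j ω) ^ 2} :=
      isClosed_le (by simp only [dotProduct]; fun_prop) (by simp only [dotProduct]; fun_prop)
    have hsub : closure (Set.range (TopologicalSpace.denseSeq (Fin n → ℝ))) ⊆ _ :=
      closure_minimal (Set.range_subset_iff.2 h) hcl
    exact hsub (TopologicalSpace.denseRange_denseSeq (Fin n → ℝ) v)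
  rw [h]
  refine MeasurableSet.iInter fun k => measurableSet_le measurable_const ?_
  refine Finset.measurable_sum _ fun j _ => ?_
  simp only [dotProduct]
  fun_prop

lemma tendsto_measure_not_excited {n : ℕ} {Ω : Type*} [MeasurableSpace Ω] {μ : Measure Ω}
    [IsProbabilityMeasure μ] {X : ℕ → Ω → Fin n → ℝ} (hX : ∀ j, Measurable (X j))
    (hexc : ∀ᵐ ω ∂μ, ∀ v : Fin n → ℝ, v ≠ 0 →
      Tendsto (fun M : ℕ => ∑ j ∈ Finset.range M, (v ⬝ᵥ X j ω) ^ 2) atTop atTop) (c : ℝ) :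
    Tendsto (fun M : ℕ => μ {ω | ¬ ∀ v : Fin n → ℝ,
      c * (v ⬝ᵥ v) ≤ ∑ j ∈ Finset.range M, (v ⬝ᵥ X j ω) ^ 2}) atTop (nhds 0) := by
  have hzero : μ (⋂ M : ℕ, {ω | ¬ ∀ v : Fin n → ℝ,
      c * (v ⬝ᵥ v) ≤ ∑ j ∈ Finset.range M, (v ⬝ᵥ X j ω) ^ 2}) = 0 := by
    rw [← compl_mem_ae_iff]
    filter_upwards [hexc] with ω hgood hω
    obtain ⟨M, hM⟩ := exists_forall_excited (fun j => X j ω) hgood c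
    exact Set.mem_iInter.1 hω M hM
  rw [← hzero]
  refine tendsto_measure_iInter_atTop
    (fun M => (measurableSet_excited hX c M).compl.nullMeasurableSet) ?_
    ⟨0, measure_ne_top _ _⟩
  intro M M' hMM' ω hω hM
  exact hω fun v => (hM v).trans (Finset.sum_le_sum_of_subset_of_nonneg
    (Finset.range_subset_range.2 hMM') fun _ _ _ => sq_nonneg _)

/-! ### The least-squares fit and its energy -/

/-- The deviation at step `i`, per initial state, between the trajectories for `Q` and `Q₀`. -/
noncomputable def loopGap {n : ℕ} (A Q₀ Q : Matrix (Fin n) (Fin n) ℝ) (N i : ℕ) :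
    Matrix (Fin n) (Fin n) ℝ :=
  closedLoop A Q N i - closedLoop A Q₀ N i

/-- The residual sum of squares of the parameter `Q`, when the data come from `Q₀`, the initial
states `x0` and the noise `w`. -/
noncomputable def fitCost {n : ℕ} (A Q₀ : Matrix (Fin n) (Fin n) ℝ) (N : ℕ → ℕ)
    (x0 : ℕ → Fin n → ℝ) (w : ℕ → ℕ → Fin n → ℝ) (M : ℕ) (Q : Matrix (Fin n) (Fin n) ℝ) : ℝ :=
  ∑ j ∈ Finset.range M, ∑ i ∈ Finset.Icc 1 (N j),
    (w j i - loopGap A Q₀ Q (N j) i *ᵥ x0 j) ⬝ᵥ (w j i - loopGap A Q₀ Q (N j) i *ᵥ x0 j)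

/-- The total squared deviation between the trajectories predicted by `Q` and by `Q₀`. -/
noncomputable def gapEnergy {n : ℕ} (A Q₀ : Matrix (Fin n) (Fin n) ℝ) (N : ℕ → ℕ)
    (x0 : ℕ → Fin n → ℝ) (M : ℕ) (Q : Matrix (Fin n) (Fin n) ℝ) : ℝ :=
  ∑ j ∈ Finset.range M, ∑ i ∈ Finset.Icc 1 (N j),
    (loopGap A Q₀ Q (N j) i *ᵥ x0 j) ⬝ᵥ (loopGap A Q₀ Q (N j) i *ᵥ x0 j)

/-- A parameter that fits at least as well as the true one owes its deviation to correlation with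
the noise. -/
lemma gapEnergy_le_of_fitCost_le {n : ℕ} {A Q₀ Q : Matrix (Fin n) (Fin n) ℝ} {N : ℕ → ℕ}
    {x0 : ℕ → Fin n → ℝ} {w : ℕ → ℕ → Fin n → ℝ} {M : ℕ}
    (h : fitCost A Q₀ N x0 w M Q ≤ fitCost A Q₀ N x0 w M Q₀) :
    gapEnergy A Q₀ N x0 M Q ≤ 2 * ∑ j ∈ Finset.range M, ∑ i ∈ Finset.Icc 1 (N j),
      w j i ⬝ᵥ (loopGap A Q₀ Q (N j) i *ᵥ x0 j) := by
  have h1 : fitCost A Q₀ N x0 w M Q = fitCost A Q₀ N x0 w M Q₀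
      - 2 * (∑ j ∈ Finset.range M, ∑ i ∈ Finset.Icc 1 (N j),
        w j i ⬝ᵥ (loopGap A Q₀ Q (N j) i *ᵥ x0 j)) + gapEnergy A Q₀ N x0 M Q := by
    unfold fitCost gapEnergy
    simp only [Finset.mul_sum, ← Finset.sum_sub_distrib, ← Finset.sum_add_distrib]
    refine Finset.sum_congr rfl fun j _ => Finset.sum_congr rfl fun i _ => ?_
    rw [loopGap.eq_1 A Q₀ Q₀, sub_self, Matrix.zero_mulVec, sub_zero, sub_dotProduct,
      dotProduct_sub, dotProduct_sub, dotProduct_comm (loopGap A Q₀ Q (N j) i *ᵥ x0 j) (w j i)]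
    ring
  linarith

/-- The regressor of the `j`-th trajectory: its initial state, placed in the block belonging to its
horizon. The predicted states for all horizons up to `L` depend linearly on it. -/
def blockRegressor {n : ℕ} (L : ℕ) (N : ℕ → ℕ) (x0 : ℕ → Fin n → ℝ) (j : ℕ) :
    Fin n × Fin (L + 1) → ℝ :=
  fun p => if (p.2 : ℕ) = N j then x0 j p.1 else 0

/-- The coefficients, with respect to `blockRegressor`, of the `r`-th coordinate of the deviation at
step `i`. -/
noncomputable def gapCoeff {n : ℕ} (A Q₀ Q : Matrix (Fin n) (Fin n) ℝ) (L i : ℕ) (r : Fin n) :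
    Fin n × Fin (L + 1) → ℝ :=
  fun p => if i ≤ (p.2 : ℕ) then loopGap A Q₀ Q (p.2 : ℕ) i r p.1 else 0

/-- The `r`-th coordinate of the noise at step `i` of trajectory `j`, or zero after the horizon. -/
def stoppedNoise {n : ℕ} (N : ℕ → ℕ) (w : ℕ → ℕ → Fin n → ℝ) (i : ℕ) (r : Fin n) (j : ℕ) : ℝ :=
  if i ≤ N j then w j i r else 0

lemma gapCoeff_dotProduct_blockRegressor {n : ℕ} (A Q₀ Q : Matrix (Fin n) (Fin n) ℝ) {L : ℕ}
    {N : ℕ → ℕ} (hL : ∀ j, N j ≤ L) (x0 : ℕ → Fin n → ℝ) (i j : ℕ) (r : Fin n) :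
    gapCoeff A Q₀ Q L i r ⬝ᵥ blockRegressor L N x0 j
      = if i ≤ N j then (loopGap A Q₀ Q (N j) i *ᵥ x0 j) r else 0 := by
  simp only [dotProduct, gapCoeff, blockRegressor, Fintype.sum_prod_type]
  have h : ∀ a : Fin n, ∑ b : Fin (L + 1),
      (if i ≤ (b : ℕ) then loopGap A Q₀ Q (b : ℕ) i r a else 0)
        * (if (b : ℕ) = N j then x0 j a else 0)
      = if i ≤ N j then loopGap A Q₀ Q (N j) i r a * x0 j a else 0 := by
    intro a
    rw [Finset.sum_eq_single (⟨N j, Nat.lt_succ_of_le (hL j)⟩ : Fin (L + 1))]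
    · simp
    · intro b _ hb
      rw [if_neg (fun hbj : (b : ℕ) = N j => hb (Fin.ext hbj)), mul_zero]
    · simp
  simp only [h]
  split_ifs
  · rfl
  · simp

lemma sum_Icc_one_eq_sum_ite {L N : ℕ} (h : N ≤ L) (f : ℕ → ℝ) :
    ∑ i ∈ Finset.Icc 1 N, f i = ∑ i ∈ Finset.Icc 1 L, if i ≤ N then f i else 0 := by
  rw [← Finset.sum_filter]
  congr 1
  ext i
  simp only [Finset.mem_Icc, Finset.mem_filter]
  omega

/-- The squared size of the part of the noise explained by the regressors, in ridge regression with
parameter `ε`, over all steps and coordinates. -/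
noncomputable def explainedNoise {n : ℕ} (L : ℕ) (N : ℕ → ℕ) (x0 : ℕ → Fin n → ℝ)
    (w : ℕ → ℕ → Fin n → ℝ) (M : ℕ) (ε : ℝ) : ℝ :=
  ∑ i ∈ Finset.Icc 1 L, ∑ r : Fin n, ∑ j ∈ Finset.range M, ∑ k ∈ Finset.range M,
    leverage (blockRegressor L N x0) (Finset.range M) ε j k
      * (stoppedNoise N w i r j * stoppedNoise N w i r k)

lemma explainedNoise_nonneg {n : ℕ} (L : ℕ) (N : ℕ → ℕ) (x0 : ℕ → Fin n → ℝ)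
    (w : ℕ → ℕ → Fin n → ℝ) (M : ℕ) {ε : ℝ} (hε : 0 < ε) :
    0 ≤ explainedNoise L N x0 w M ε := by
  refine Finset.sum_nonneg fun i _ => Finset.sum_nonneg fun r _ => ?_
  have := two_mul_sum_mul_predictor_le (blockRegressor L N x0) (Finset.range M) hε
    (stoppedNoise N w i r) 0
  simp only [zero_dotProduct, mul_zero, Finset.sum_const_zero, zero_add, ne_eq,
    OfNat.ofNat_ne_zero, not_false_eq_true, zero_pow] at this
  linarith

/-- A parameter that fits at least as well as the true one deviates, up to a ridge term, by no more
than the noise that the regressors explain. -/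
lemma gapEnergy_le_explainedNoise {n : ℕ} {A Q₀ Q : Matrix (Fin n) (Fin n) ℝ} {L : ℕ} {N : ℕ → ℕ}
    (hL : ∀ j, N j ≤ L) {x0 : ℕ → Fin n → ℝ} {w : ℕ → ℕ → Fin n → ℝ} {M : ℕ}
    (h : fitCost A Q₀ N x0 w M Q ≤ fitCost A Q₀ N x0 w M Q₀) {ε : ℝ} (hε : 0 < ε) :
    gapEnergy A Q₀ N x0 M Q ≤ 4 * explainedNoise L N x0 w M ε
      + ε * ∑ i ∈ Finset.Icc 1 L, ∑ r : Fin n, gapCoeff A Q₀ Q L i r ⬝ᵥ gapCoeff A Q₀ Q L i r := by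
  have hcorr : ∑ j ∈ Finset.range M, ∑ i ∈ Finset.Icc 1 (N j),
      w j i ⬝ᵥ (loopGap A Q₀ Q (N j) i *ᵥ x0 j)
      = ∑ i ∈ Finset.Icc 1 L, ∑ r : Fin n, ∑ j ∈ Finset.range M,
        stoppedNoise N w i r j * (gapCoeff A Q₀ Q L i r ⬝ᵥ blockRegressor L N x0 j) := by
    have h1 : ∀ i, ∑ r : Fin n, ∑ j ∈ Finset.range M,
        stoppedNoise N w i r j * (gapCoeff A Q₀ Q L i r ⬝ᵥ blockRegressor L N x0 j)
        = ∑ j ∈ Finset.range M,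
          if i ≤ N j then w j i ⬝ᵥ (loopGap A Q₀ Q (N j) i *ᵥ x0 j) else 0 := by
      intro i
      rw [Finset.sum_comm]
      refine Finset.sum_congr rfl fun j _ => ?_
      simp only [gapCoeff_dotProduct_blockRegressor A Q₀ Q hL, stoppedNoise]
      split_ifs
      · rfl
      · simp
    simp only [h1]
    rw [Finset.sum_comm]
    exact Finset.sum_congr rfl fun j _ => sum_Icc_one_eq_sum_ite (hL j) _
  have henergy : gapEnergy A Q₀ N x0 M Q
      = ∑ i ∈ Finset.Icc 1 L, ∑ r : Fin n, ∑ j ∈ Finset.range M,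
        (gapCoeff A Q₀ Q L i r ⬝ᵥ blockRegressor L N x0 j) ^ 2 := by
    have h1 : ∀ i, ∑ r : Fin n, ∑ j ∈ Finset.range M,
        (gapCoeff A Q₀ Q L i r ⬝ᵥ blockRegressor L N x0 j) ^ 2
        = ∑ j ∈ Finset.range M, if i ≤ N j then
          (loopGap A Q₀ Q (N j) i *ᵥ x0 j) ⬝ᵥ (loopGap A Q₀ Q (N j) i *ᵥ x0 j) else 0 := by
      intro i
      rw [Finset.sum_comm]
      refine Finset.sum_congr rfl fun j _ => ?_
      simp only [gapCoeff_dotProduct_blockRegressor A Q₀ Q hL]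
      split_ifs
      · simp only [sq]; rfl
      · simp
    simp only [h1]
    rw [Finset.sum_comm]
    exact Finset.sum_congr rfl fun j _ => sum_Icc_one_eq_sum_ite (hL j) _
  have hle := gapEnergy_le_of_fitCost_le h
  have hsum : 2 * ∑ i ∈ Finset.Icc 1 L, ∑ r : Fin n, ∑ j ∈ Finset.range M,
        stoppedNoise N w i r j * (gapCoeff A Q₀ Q L i r ⬝ᵥ blockRegressor L N x0 j)
      ≤ 1 / 2 * (ε * ∑ i ∈ Finset.Icc 1 L, ∑ r : Fin n,
          gapCoeff A Q₀ Q L i r ⬝ᵥ gapCoeff A Q₀ Q L i r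
        + ∑ i ∈ Finset.Icc 1 L, ∑ r : Fin n, ∑ j ∈ Finset.range M,
          (gapCoeff A Q₀ Q L i r ⬝ᵥ blockRegressor L N x0 j) ^ 2)
        + 2 * explainedNoise L N x0 w M ε := by
    have h1 := Finset.sum_le_sum fun i (_ : i ∈ Finset.Icc 1 L) => Finset.sum_le_sum
      fun r (_ : r ∈ (Finset.univ : Finset (Fin n))) =>
        two_mul_sum_mul_predictor_le (blockRegressor L N x0) (Finset.range M) hε
          (stoppedNoise N w i r) (gapCoeff A Q₀ Q L i r)
    simp only [← Finset.mul_sum, Finset.sum_add_distrib] at h1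
    exact h1
  rw [hcorr] at hle
  rw [← henergy] at hsum
  linarith

/-- The energy bounds the deviation of `Q`: one step of the dynamics links the last two states of
every trajectory by `Q x_N = A x_{N-1} - x_N`. -/
lemma sub_mul_norm_sq_le_of_gapEnergy_le {n : ℕ} {A Q₀ Q : Matrix (Fin n) (Fin n) ℝ}
    (hQ₀ : Q₀.PosSemidef) (hQ : Q.PosSemidef) {N : ℕ → ℕ} (hN : ∀ j, 2 ≤ N j)
    {x0 : ℕ → Fin n → ℝ} {M : ℕ} {c d : ℝ}
    (hexc : ∀ v : Fin n → ℝ, c * (v ⬝ᵥ v)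
      ≤ ∑ j ∈ Finset.range M, (v ⬝ᵥ (closedLoop A Q₀ (N j) (N j) *ᵥ x0 j)) ^ 2)
    (hd : gapEnergy A Q₀ N x0 M Q ≤ d) :
    (c - 2 * d) * ‖Q - Q₀‖ ^ 2 ≤ 4 * (‖Q₀ + 1‖ ^ 2 + ‖A‖ ^ 2) * d := by
  have hlast : ∀ {P : Matrix (Fin n) (Fin n) ℝ}, P.PosSemidef → ∀ j,
      P * closedLoop A P (N j) (N j)
        = A * closedLoop A P (N j) (N j - 1) - closedLoop A P (N j) (N j) := by
    intro P hP j
    have h := closedLoop_succ A hP (N j) (N j - 1)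
    rw [Nat.sub_add_cancel (by linarith [hN j]), Nat.sub_self, pow_zero, Matrix.mul_one] at h
    exact eq_sub_of_add_eq' (eq_sub_iff_add_eq.1 h)
  refine sub_mul_frobenius_norm_sq_le A Q Q₀ (Finset.range M)
    (fun j => closedLoop A Q₀ (N j) (N j) *ᵥ x0 j) (fun j => loopGap A Q₀ Q (N j) (N j) *ᵥ x0 j)
    (fun j => loopGap A Q₀ Q (N j) (N j - 1) *ᵥ x0 j) hexc (fun j _ => ?_) (le_trans ?_ hd)
  · rw [← Matrix.add_mulVec, loopGap, loopGap, add_sub_cancel, Matrix.mulVec_mulVec, hlast hQ,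
      Matrix.mulVec_mulVec, hlast hQ₀, Matrix.mulVec_mulVec, Matrix.mul_sub]
    simp only [Matrix.sub_mulVec]
    abel
  · refine Finset.sum_le_sum fun j _ => ?_
    have hj := hN j
    rw [← Finset.sum_pair (f := fun i => (loopGap A Q₀ Q (N j) i *ᵥ x0 j) ⬝ᵥ
      (loopGap A Q₀ Q (N j) i *ᵥ x0 j)) (show N j ≠ N j - 1 by omega)]
    refine Finset.sum_le_sum_of_subset_of_nonneg ?_ fun _ _ _ => dotProduct_self_nonneg_real _
    intro i hi
    simp only [Finset.mem_insert, Finset.mem_singleton] at hi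
    rw [Finset.mem_Icc]
    omega

/-- Bounded energy and strong enough excitation identify the weight up to `δ`. -/
lemma exists_excitation_forall_norm_inv_sub_le {n m : ℕ} (A : Matrix (Fin n) (Fin n) ℝ)
    (B : Matrix (Fin n) (Fin m) ℝ) (hB : B.rank = m) {R : Matrix (Fin m) (Fin m) ℝ}
    (hR : R.PosDef) {N : ℕ → ℕ} (hN : ∀ j, 2 ≤ N j) {δ : ℝ} (hδ : 0 < δ) {d : ℝ} (hd : 0 ≤ d) :
    ∃ c : ℝ, ∀ (x0 : ℕ → Fin n → ℝ) (M : ℕ),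
      (∀ v : Fin n → ℝ, c * (v ⬝ᵥ v) ≤ ∑ j ∈ Finset.range M,
        (v ⬝ᵥ (closedLoop A (B * R⁻¹ * Bᵀ) (N j) (N j) *ᵥ x0 j)) ^ 2) →
      ∀ R' : Matrix (Fin m) (Fin m) ℝ, R'.PosDef →
        gapEnergy A (B * R⁻¹ * Bᵀ) N x0 M (B * R'⁻¹ * Bᵀ) ≤ d → ‖R'⁻¹ - R⁻¹‖ ≤ δ := by
  obtain ⟨L, hL⟩ := exists_mul_eq_one_of_rank_eq B hB
  set Q₀ := B * R⁻¹ * Bᵀ with hQ₀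
  set C : ℝ := 4 * (‖Q₀ + 1‖ ^ 2 + ‖A‖ ^ 2) * d with hC
  have hC0 : 0 ≤ C := by positivity
  set η : ℝ := δ / (‖L‖ * ‖Lᵀ‖ + 1) with hη
  have hη0 : 0 < η := by positivity
  refine ⟨2 * d + (C + 1) / η ^ 2, fun x0 M hexc R' hR' henergy => ?_⟩
  have h := sub_mul_norm_sq_le_of_gapEnergy_le (posSemidef_mul_inv_mul_transpose B hR)
    (posSemidef_mul_inv_mul_transpose B hR') hN hexc henergy
  rw [add_sub_cancel_left, ← hQ₀, ← hC, div_mul_eq_mul_div, div_le_iff₀ (by positivity)] at h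
  have h1 : ‖B * R'⁻¹ * Bᵀ - Q₀‖ ≤ η := by
    refine (pow_le_pow_iff_left₀ (norm_nonneg _) hη0.le two_ne_zero).1 ?_
    have h2 : (C + 1) * ‖B * R'⁻¹ * Bᵀ - Q₀‖ ^ 2 ≤ (C + 1) * η ^ 2 := by
      nlinarith [sq_nonneg η]
    exact le_of_mul_le_mul_left h2 (by linarith)
  calc ‖R'⁻¹ - R⁻¹‖ ≤ ‖L‖ * ‖B * R'⁻¹ * Bᵀ - Q₀‖ * ‖Lᵀ‖ := norm_sub_le_of_mul_eq_one hL _ _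
    _ ≤ ‖L‖ * η * ‖Lᵀ‖ := by gcongr
    _ = (‖L‖ * ‖Lᵀ‖) / (‖L‖ * ‖Lᵀ‖ + 1) * δ := by rw [hη]; ring
    _ ≤ 1 * δ := by
        gcongr
        rw [div_le_one (by positivity)]
        linarith
    _ = δ := one_mul δ

/-! ### Existence of the estimator -/

lemma exists_posDef_of_norm_sub_le {m : ℕ} {P₀ : Matrix (Fin m) (Fin m) ℝ} (hP₀ : P₀.PosDef) :
    ∃ δ > 0, ∀ P : Matrix (Fin m) (Fin m) ℝ, P.IsHermitian → ‖P - P₀‖ ≤ δ → P.PosDef := by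
  obtain ⟨c, hc, hcf⟩ : ∃ c > 0, ∀ v : Fin m → ℝ, c * (v ⬝ᵥ v) ≤ v ⬝ᵥ (P₀ *ᵥ v) := by
    set k : ℝ := ‖P₀⁻¹‖ + 1 with hk
    have hk0 : 0 < k := by positivity
    have hsymm : P₀ᵀ = P₀ := by
      simpa [Matrix.conjTranspose_eq_transpose_of_trivial] using hP₀.isHermitian.eq
    refine ⟨k⁻¹, by positivity, fun v => ?_⟩
    set u := P₀⁻¹ *ᵥ v with hu
    have hPu : P₀ *ᵥ u = v := by
      rw [hu, Matrix.mulVec_mulVec, Matrix.mul_nonsing_inv _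
        ((Matrix.isUnit_iff_isUnit_det _).1 hP₀.isUnit), Matrix.one_mulVec]
    have huP : u ⬝ᵥ (P₀ *ᵥ v) = v ⬝ᵥ v := by
      rw [Matrix.dotProduct_mulVec, ← Matrix.mulVec_transpose, hsymm, hPu]
    -- combine two nonnegative quadratic forms of `k v - u` with `u ⬝ u ≤ k² (v ⬝ v)`
    have h1 : 0 ≤ (k • v - u) ⬝ᵥ (P₀ *ᵥ (k • v - u)) := by
      simpa using hP₀.posSemidef.dotProduct_mulVec_nonneg (k • v - u)
    have h2 := dotProduct_self_nonneg_real (k • v - u)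
    have h3 : u ⬝ᵥ u ≤ k ^ 2 * (v ⬝ᵥ v) :=
      (mulVec_dotProduct_self_le P₀⁻¹ v).trans (mul_le_mul_of_nonneg_right
        (pow_le_pow_left₀ (norm_nonneg _) (by linarith) 2) (dotProduct_self_nonneg_real v))
    simp only [Matrix.mulVec_sub, Matrix.mulVec_smul, hPu, sub_dotProduct, dotProduct_sub,
      smul_dotProduct, dotProduct_smul, smul_eq_mul, huP, dotProduct_comm u v] at h1 h2
    have h4 : 0 ≤ k * (k * (v ⬝ᵥ v) - v ⬝ᵥ u) := by nlinarith
    have h5 := nonneg_of_mul_nonneg_right h4 hk0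
    have h6 : 0 ≤ k * (k * (v ⬝ᵥ (P₀ *ᵥ v)) - v ⬝ᵥ v) := by nlinarith
    have h7 := nonneg_of_mul_nonneg_right h6 hk0
    rw [inv_mul_le_iff₀ hk0]
    linarith
  refine ⟨c / 2, by positivity, fun P hP hle => ?_⟩
  refine Matrix.posDef_iff_dotProduct_mulVec.2 ⟨hP, fun v hv => ?_⟩
  have hvv : 0 < v ⬝ᵥ v := (dotProduct_self_nonneg_real v).lt_of_ne'
    fun h => hv (dotProduct_self_eq_zero.1 h)
  have h1 : v ⬝ᵥ (P *ᵥ v) = v ⬝ᵥ (P₀ *ᵥ v) + v ⬝ᵥ ((P - P₀) *ᵥ v) := by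
    rw [Matrix.sub_mulVec, dotProduct_sub, add_sub_cancel]
  -- `|v ⬝ (P - P₀) v| ≤ (c / 2) (v ⬝ v)`, from `0 ≤ |(c / 2) v + (P - P₀) v|²`
  have h2 := mulVec_dotProduct_self_le (P - P₀) v
  have h3 := dotProduct_self_nonneg_real ((c / 2) • v + (P - P₀) *ᵥ v)
  have h4 : ‖P - P₀‖ ^ 2 * (v ⬝ᵥ v) ≤ (c / 2) ^ 2 * (v ⬝ᵥ v) :=
    mul_le_mul_of_nonneg_right (pow_le_pow_left₀ (norm_nonneg _) hle 2) hvv.le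
  simp only [add_dotProduct, dotProduct_add, smul_dotProduct, dotProduct_smul, smul_eq_mul,
    dotProduct_comm ((P - P₀) *ᵥ v) v] at h3
  have h5 : 0 ≤ c * (c / 2 * (v ⬝ᵥ v) + v ⬝ᵥ ((P - P₀) *ᵥ v)) := by nlinarith
  have h6 := nonneg_of_mul_nonneg_right h5 hc
  have h7 := hcf v
  rw [star_trivial, h1]
  nlinarith [mul_pos hc hvv]

lemma continuousAt_closedLoop {n : ℕ} (A : Matrix (Fin n) (Fin n) ℝ)
    {Q : Matrix (Fin n) (Fin n) ℝ} (hQ : Q.PosSemidef) (N i : ℕ) :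
    ContinuousAt (fun Q => closedLoop A Q N i) Q := by
  have hG : ∀ i, Continuous fun Q => reachGramian A Q N i := fun i => by
    unfold reachGramian
    fun_prop
  have hinv : ContinuousAt (fun Q => (1 + reachGramian A Q N N)⁻¹) Q := by
    refine ContinuousAt.comp (g := Inv.inv) (continuousAt_matrix_inv _ ?_)
      (continuous_const.add (hG N)).continuousAt
    rw [Ring.inverse_eq_inv']
    exact continuousAt_inv₀ (isUnit_det_one_add_reachGramian A hQ N).ne_zero
  unfold closedLoop
  exact continuousAt_const.sub ((hG i).continuousAt.mul (hinv.mul continuousAt_const))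

lemma continuousAt_fitCost {n : ℕ} (A Q₀ : Matrix (Fin n) (Fin n) ℝ) (N : ℕ → ℕ)
    (x0 : ℕ → Fin n → ℝ) (w : ℕ → ℕ → Fin n → ℝ) (M : ℕ) {Q : Matrix (Fin n) (Fin n) ℝ}
    (hQ : Q.PosSemidef) : ContinuousAt (fitCost A Q₀ N x0 w M) Q := by
  unfold fitCost
  refine tendsto_finsetSum _ fun j _ => tendsto_finsetSum _ fun i _ => ?_
  have h : ContinuousAt (fun Q => w j i - loopGap A Q₀ Q (N j) i *ᵥ x0 j) Q := by
    unfold loopGap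
    have h1 := continuousAt_closedLoop A hQ (N j) i
    have h2 : Continuous fun C : Matrix (Fin n) (Fin n) ℝ =>
        w j i - (C - closedLoop A Q₀ (N j) i) *ᵥ x0 j := by fun_prop
    exact ContinuousAt.comp (f := fun Q => closedLoop A Q (N j) i) h2.continuousAt h1
  have h3 : Continuous fun v : Fin n → ℝ => v ⬝ᵥ v := by
    simp only [dotProduct]
    fun_prop
  exact ContinuousAt.comp (f := fun Q => w j i - loopGap A Q₀ Q (N j) i *ᵥ x0 j)
    h3.continuousAt h

/-- If every weight that fits at least as well as the true one has its inverse in a small ball, the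
fit has a minimum over all positive definite weights. -/
lemma exists_posDef_forall_fitCost_le {n m : ℕ} (A : Matrix (Fin n) (Fin n) ℝ)
    (B : Matrix (Fin n) (Fin m) ℝ) {R : Matrix (Fin m) (Fin m) ℝ} (hR : R.PosDef) (N : ℕ → ℕ)
    (x0 : ℕ → Fin n → ℝ) (w : ℕ → ℕ → Fin n → ℝ) (M : ℕ) {δ : ℝ}
    (hδ : ∀ P : Matrix (Fin m) (Fin m) ℝ, P.IsHermitian → ‖P - R⁻¹‖ ≤ δ → P.PosDef)
    (hclose : ∀ R' : Matrix (Fin m) (Fin m) ℝ, R'.PosDef →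
      fitCost A (B * R⁻¹ * Bᵀ) N x0 w M (B * R'⁻¹ * Bᵀ)
        ≤ fitCost A (B * R⁻¹ * Bᵀ) N x0 w M (B * R⁻¹ * Bᵀ) → ‖R'⁻¹ - R⁻¹‖ ≤ δ) :
    ∃ R' : Matrix (Fin m) (Fin m) ℝ, R'.PosDef ∧
      ∀ R'' : Matrix (Fin m) (Fin m) ℝ, R''.PosDef →
        fitCost A (B * R⁻¹ * Bᵀ) N x0 w M (B * R'⁻¹ * Bᵀ)
          ≤ fitCost A (B * R⁻¹ * Bᵀ) N x0 w M (B * R''⁻¹ * Bᵀ) := by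
  let _ := Matrix.frobeniusNormedSpace (R := ℝ) (m := Fin m) (n := Fin m) (α := ℝ)
  have : FiniteDimensional ℝ (Matrix (Fin m) (Fin m) ℝ) := Module.Finite.matrix
  have : ProperSpace (Matrix (Fin m) (Fin m) ℝ) := FiniteDimensional.proper ℝ _
  set F := fitCost A (B * R⁻¹ * Bᵀ) N x0 w M with hF
  set K : Set (Matrix (Fin m) (Fin m) ℝ) :=
    Metric.closedBall R⁻¹ δ ∩ {P | P.IsHermitian} with hK
  have hmem : ∀ P, P ∈ K ↔ ‖P - R⁻¹‖ ≤ δ ∧ P.IsHermitian := fun P => by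
    rw [hK, Set.mem_inter_iff, Metric.mem_closedBall, dist_eq_norm, Set.mem_ofPred_eq]
  have hcpt : IsCompact K := by
    refine (isCompact_closedBall _ _).inter_right ?_
    have h : Continuous fun P : Matrix (Fin m) (Fin m) ℝ => Pᴴ := by fun_prop
    exact isClosed_eq h continuous_id
  have hself : R⁻¹ ∈ K := (hmem _).2 ⟨hclose R hR le_rfl, hR.inv.isHermitian⟩
  have hcont : ContinuousOn (fun P => F (B * P * Bᵀ)) K := by
    intro P hP
    have hPD := hδ P ((hmem P).1 hP).2 ((hmem P).1 hP).1
    have hPS : (B * P * Bᵀ).PosSemidef := by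
      have := hPD.posSemidef.mul_mul_conjTranspose_same B
      rwa [Matrix.conjTranspose_eq_transpose_of_trivial] at this
    have h : Continuous fun P : Matrix (Fin m) (Fin m) ℝ => B * P * Bᵀ := by fun_prop
    exact (ContinuousAt.comp (f := fun P : Matrix (Fin m) (Fin m) ℝ => B * P * Bᵀ)
      (continuousAt_fitCost A _ N x0 w M hPS) h.continuousAt).continuousWithinAt
  obtain ⟨P, hPK, hPmin⟩ := hcpt.exists_isMinOn ⟨_, hself⟩ hcont
  have hPD := hδ P ((hmem P).1 hPK).2 ((hmem P).1 hPK).1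
  have hPinv : P⁻¹⁻¹ = P :=
    Matrix.nonsing_inv_nonsing_inv _ ((Matrix.isUnit_iff_isUnit_det _).1 hPD.isUnit)
  refine ⟨P⁻¹, hPD.inv, fun R'' hR'' => ?_⟩
  rw [hPinv]
  rcases le_or_gt (F (B * R''⁻¹ * Bᵀ)) (F (B * R⁻¹ * Bᵀ)) with hle | hlt
  · exact hPmin ((hmem _).2 ⟨hclose R'' hR'' hle, hR''.inv.isHermitian⟩)
  · exact (hPmin hself).trans hlt.le

/-! ### The explained noise is bounded in probability -/

lemma measurable_blockRegressor {n : ℕ} (L : ℕ) (N : ℕ → ℕ) :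
    Measurable fun x0 : ℕ → Fin n → ℝ => blockRegressor L N x0 := by
  refine measurable_pi_lambda _ fun j => measurable_pi_lambda _ fun p => ?_
  unfold blockRegressor
  split_ifs
  · fun_prop
  · exact measurable_const

lemma integrable_explainedNoise_and_integral_le {n : ℕ} {Ω : Type*} [MeasurableSpace Ω]
    {μ : Measure Ω} [IsProbabilityMeasure μ] {X : Ω → ℕ → Fin n → ℝ} (hX : Measurable X)
    {noise : ℕ → ℕ → Ω → Fin n → ℝ} (hnoise_sq : ∀ j k, MemLp (noise j k) 2 μ)
    {σ : ℝ} (hσ : ∀ j k, ∫ ω, noise j k ω ⬝ᵥ noise j k ω ∂μ ≤ σ)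
    (hmean : ∀ j k, ∫ ω, noise j k ω ∂μ = 0)
    (hindep : iIndepFun (fun (j : ℕ) (ω : Ω) (k : ℕ) => noise j k ω) μ)
    (hXnoise : IndepFun X (fun (ω : Ω) (j k : ℕ) => noise j k ω) μ) (L : ℕ) (N : ℕ → ℕ) (M : ℕ)
    {ε : ℝ} (hε : 0 < ε) :
    Integrable (fun ω => explainedNoise L N (X ω) (fun j k => noise j k ω) M ε) μ ∧
    ∫ ω, explainedNoise L N (X ω) (fun j k => noise j k ω) M ε ∂μ
      ≤ L * (n * (σ * Fintype.card (Fin n × Fin (L + 1)))) := by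
  have hσ0 : 0 ≤ σ :=
    (integral_nonneg fun ω => dotProduct_self_nonneg_real (noise 0 0 ω)).trans (hσ 0 0)
  -- the coordinates of the noise
  have hcoord : ∀ j k (r : Fin n), MemLp (fun ω => noise j k ω r) 2 μ := fun j k r =>
    (ContinuousLinearMap.proj (R := ℝ) (φ := fun _ : Fin n => ℝ) r).comp_memLp' (hnoise_sq j k)
  have hcmean : ∀ j k (r : Fin n), ∫ ω, noise j k ω r ∂μ = 0 := fun j k r => by
    have h := (ContinuousLinearMap.proj (R := ℝ) (φ := fun _ : Fin n => ℝ) r).integral_comp_comm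
      ((hnoise_sq j k).integrable one_le_two)
    rw [hmean] at h
    simpa using h
  have hcsq : ∀ j k (r : Fin n), ∫ ω, noise j k ω r * noise j k ω r ∂μ ≤ σ := fun j k r => by
    refine (integral_mono ((hcoord j k r).integrable_mul (hcoord j k r)) ?_ fun ω => ?_).trans
      (hσ j k)
    · exact integrable_finsetSum _ fun s _ => (hcoord j k s).integrable_mul (hcoord j k s)
    · exact Finset.single_le_sum (f := fun s => noise j k ω s * noise j k ω s)
        (fun s _ => mul_self_nonneg _) (Finset.mem_univ r)
  have hone := fun i r => integrable_leverage_sum_and_integral_le hX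
    (measurable_blockRegressor L N)
    (w := fun j ω => stoppedNoise N (fun j k => noise j k ω) i r j) (σ := σ)
    (fun j => by
      unfold stoppedNoise
      split_ifs
      · exact hcoord j i r
      · exact MemLp.zero')
    (fun j => by
      unfold stoppedNoise
      split_ifs
      · exact hcsq j i r
      · simpa using hσ0)
    (fun j k hjk => by
      unfold stoppedNoise
      split_ifs
      · have h : IndepFun (fun ω => noise j i ω r) (fun ω => noise k i ω r) μ :=
          (hindep.indepFun hjk).comp (φ := fun f : ℕ → Fin n → ℝ => f i r)
            (ψ := fun f : ℕ → Fin n → ℝ => f i r) (by fun_prop) (by fun_prop)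
        rw [h.integral_fun_mul_eq_mul_integral (hcoord j i r).aestronglyMeasurable
          (hcoord k i r).aestronglyMeasurable, hcmean, zero_mul]
      all_goals simp)
    (fun j k => by
      refine hXnoise.comp (φ := id) (ψ := fun f : ℕ → ℕ → Fin n → ℝ =>
        stoppedNoise N f i r j * stoppedNoise N f i r k) measurable_id ?_
      unfold stoppedNoise
      split_ifs <;> fun_prop)
    (Finset.range M) hε
  have hint : ∀ i, Integrable (fun ω => ∑ r : Fin n, ∑ j ∈ Finset.range M, ∑ k ∈ Finset.range M,
      leverage (blockRegressor L N (X ω)) (Finset.range M) ε j k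
        * (stoppedNoise N (fun j k => noise j k ω) i r j
          * stoppedNoise N (fun j k => noise j k ω) i r k)) μ :=
    fun i => integrable_finsetSum _ fun r _ => (hone i r).1
  unfold explainedNoise
  refine ⟨integrable_finsetSum _ fun i _ => hint i, ?_⟩
  rw [integral_finsetSum _ fun i _ => hint i]
  calc _ ≤ ∑ i ∈ Finset.Icc 1 L, ∑ r : Fin n, σ * Fintype.card (Fin n × Fin (L + 1)) := by
        refine Finset.sum_le_sum fun i _ => ?_
        rw [integral_finsetSum _ fun r _ => (hone i r).1]
        exact Finset.sum_le_sum fun r _ => (hone i r).2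
    _ = _ := by simp

/-- The deviation energy of all parameters that fit at least as well as the true one is bounded in
probability, uniformly in the number of trajectories. The ridge parameter is sent to zero for each
outcome separately, since the coefficients of these parameters are not bounded. -/
lemma measure_exists_gapEnergy_gt_le {n m : ℕ} (A : Matrix (Fin n) (Fin n) ℝ)
    (B : Matrix (Fin n) (Fin m) ℝ) (R : Matrix (Fin m) (Fin m) ℝ) {Ω : Type*} [MeasurableSpace Ω]
    {μ : Measure Ω} [IsProbabilityMeasure μ] {X : Ω → ℕ → Fin n → ℝ} (hX : Measurable X)
    {noise : ℕ → ℕ → Ω → Fin n → ℝ} (hnoise : ∀ j k, Measurable (noise j k))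
    (hnoise_sq : ∀ j k, MemLp (noise j k) 2 μ)
    {σ : ℝ} (hσ : ∀ j k, ∫ ω, noise j k ω ⬝ᵥ noise j k ω ∂μ ≤ σ)
    (hmean : ∀ j k, ∫ ω, noise j k ω ∂μ = 0)
    (hindep : iIndepFun (fun (j : ℕ) (ω : Ω) (k : ℕ) => noise j k ω) μ)
    (hXnoise : IndepFun X (fun (ω : Ω) (j k : ℕ) => noise j k ω) μ) {L : ℕ} {N : ℕ → ℕ}
    (hL : ∀ j, N j ≤ L) (M : ℕ) {d : ℝ} (hd : 0 < d) :
    μ {ω | ∃ R' : Matrix (Fin m) (Fin m) ℝ,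
        fitCost A (B * R⁻¹ * Bᵀ) N (X ω) (fun j k => noise j k ω) M (B * R'⁻¹ * Bᵀ)
          ≤ fitCost A (B * R⁻¹ * Bᵀ) N (X ω) (fun j k => noise j k ω) M (B * R⁻¹ * Bᵀ) ∧
        d < gapEnergy A (B * R⁻¹ * Bᵀ) N (X ω) M (B * R'⁻¹ * Bᵀ)}
      ≤ ENNReal.ofReal (L * (n * (σ * Fintype.card (Fin n × Fin (L + 1)))) / (d / 4)) := by
  set K : ℝ := L * (n * (σ * Fintype.card (Fin n × Fin (L + 1)))) with hK
  set ε : ℕ → ℝ := fun k => 1 / ((k : ℝ) + 1) with hε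
  have hε0 : ∀ k, 0 < ε k := fun k => by positivity
  set V : ℕ → Ω → ℝ := fun k ω =>
    explainedNoise L N (X ω) (fun j k => noise j k ω) M (ε k) with hV
  have hVint := fun k => integrable_explainedNoise_and_integral_le hX hnoise_sq hσ hmean hindep
    hXnoise L N M (hε0 k)
  have hVmeas : ∀ k, Measurable fun ω => ENNReal.ofReal (V k ω) := by
    intro k
    refine ENNReal.measurable_ofReal.comp ?_
    refine Finset.measurable_sum _ fun i _ => Finset.measurable_sum _ fun r _ =>
      Finset.measurable_sum _ fun j _ => Finset.measurable_sum _ fun l _ => ?_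
    refine Measurable.mul ?_ (Measurable.mul ?_ ?_)
    · exact (continuous_leverage _ (hε0 k) j l).measurable.comp
        ((measurable_blockRegressor L N).comp hX)
    all_goals
      unfold stoppedNoise
      split_ifs
      · exact (measurable_pi_apply r).comp (hnoise _ _)
      · exact measurable_const
  have hfatou : ∫⁻ ω, liminf (fun k => ENNReal.ofReal (V k ω)) atTop ∂μ ≤ ENNReal.ofReal K := by
    refine (lintegral_liminf_le hVmeas).trans ?_
    refine liminf_le_of_frequently_le' (Eventually.of_forall fun k => ?_).frequently
    rw [← ofReal_integral_eq_lintegral_ofReal (hVint k).1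
      (Eventually.of_forall fun ω => explainedNoise_nonneg L N _ _ M (hε0 k))]
    exact ENNReal.ofReal_le_ofReal (hVint k).2
  have hsub : {ω | ∃ R' : Matrix (Fin m) (Fin m) ℝ,
        fitCost A (B * R⁻¹ * Bᵀ) N (X ω) (fun j k => noise j k ω) M (B * R'⁻¹ * Bᵀ)
          ≤ fitCost A (B * R⁻¹ * Bᵀ) N (X ω) (fun j k => noise j k ω) M (B * R⁻¹ * Bᵀ) ∧
        d < gapEnergy A (B * R⁻¹ * Bᵀ) N (X ω) M (B * R'⁻¹ * Bᵀ)}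
      ⊆ {ω | ENNReal.ofReal (d / 4) ≤ liminf (fun k => ENNReal.ofReal (V k ω)) atTop} := by
    intro ω hω
    rw [Set.mem_ofPred_eq] at hω ⊢
    obtain ⟨R', hfit, hgt⟩ := hω
    set C := ∑ i ∈ Finset.Icc 1 L, ∑ r : Fin n,
      gapCoeff A (B * R⁻¹ * Bᵀ) (B * R'⁻¹ * Bᵀ) L i r
        ⬝ᵥ gapCoeff A (B * R⁻¹ * Bᵀ) (B * R'⁻¹ * Bᵀ) L i r with hC
    have hlim : Tendsto (fun k => ε k * C) atTop (nhds 0) := by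
      simpa only [zero_mul] using
        (tendsto_one_div_add_atTop_nhds_zero_nat (𝕜 := ℝ)).mul_const C
    refine le_liminf_of_le (by isBoundedDefault) ?_
    filter_upwards [hlim.eventually_lt_const (sub_pos.2 hgt)] with k hk
    have h := gapEnergy_le_explainedNoise hL hfit (hε0 k)
    rw [← hC] at h
    refine ENNReal.ofReal_le_ofReal ?_
    have : V k ω = explainedNoise L N (X ω) (fun j k => noise j k ω) M (ε k) := rfl
    linarith
  calc _ ≤ μ {ω | ENNReal.ofReal (d / 4) ≤ liminf (fun k => ENNReal.ofReal (V k ω)) atTop} :=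
        measure_mono hsub
    _ ≤ (∫⁻ ω, liminf (fun k => ENNReal.ofReal (V k ω)) atTop ∂μ) / ENNReal.ofReal (d / 4) :=
        meas_ge_le_lintegral_div (Measurable.liminf hVmeas).aemeasurable
          (ENNReal.ofReal_pos.2 (by positivity)).ne' ENNReal.ofReal_ne_top
    _ ≤ ENNReal.ofReal K / ENNReal.ofReal (d / 4) := by gcongr
    _ = ENNReal.ofReal (K / (d / 4)) := (ENNReal.ofReal_div_of_pos (by positivity)).symm

/-! ### The inverse problem as a least-squares fit -/

lemma IsIOCFeasible.iocCost_eq {n m : ℕ} {A : Matrix (Fin n) (Fin n) ℝ}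
    {B : Matrix (Fin n) (Fin m) ℝ} {xT : Fin n → ℝ} {N : ℕ → ℕ} {y : ℕ → ℕ → Fin n → ℝ} {M : ℕ}
    {R' : Matrix (Fin m) (Fin m) ℝ} {x l : ℕ → ℕ → Fin n → ℝ}
    (h : IsIOCFeasible A B 1 xT N y M R' x l) {Q₀ : Matrix (Fin n) (Fin n) ℝ}
    {w : ℕ → ℕ → Fin n → ℝ}
    (hy : ∀ j k, 1 ≤ k → k ≤ N j →
      y j k = xT + closedLoop A Q₀ (N j) k *ᵥ (y j 0 - xT) + w j k) :
    iocCost xT N y x M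
      = 1 / (M : ℝ) * fitCost A Q₀ N (fun j => y j 0 - xT) w M (B * R'⁻¹ * Bᵀ) := by
  unfold iocCost fitCost
  congr 1
  refine Finset.sum_congr rfl fun j hj => Finset.sum_congr rfl fun i hi => ?_
  rw [Finset.mem_Icc] at hi
  have h1 : y j i - xT - x j i
      = w j i - loopGap A Q₀ (B * R'⁻¹ * Bᵀ) (N j) i *ᵥ (y j 0 - xT) := by
    rw [hy j i hi.1 hi.2, (h.pmp j (Finset.mem_range.1 hj)).state_eq
      (posSemidef_mul_inv_mul_transpose B h.posDef) hi.2, loopGap, Matrix.sub_mulVec]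
    abel
  rw [h1]

lemma exists_isIOCFeasible {n m : ℕ} (A : Matrix (Fin n) (Fin n) ℝ)
    (B : Matrix (Fin n) (Fin m) ℝ) (xT : Fin n → ℝ) (N : ℕ → ℕ) (y : ℕ → ℕ → Fin n → ℝ) (M : ℕ)
    {R' : Matrix (Fin m) (Fin m) ℝ} (hR' : R'.PosDef) :
    ∃ x l : ℕ → ℕ → Fin n → ℝ, IsIOCFeasible A B 1 xT N y M R' x l :=
  ⟨_, _, hR', fun j _ => isPMPTrajectory_closedLoop A B R' (N j) (y j 0 - xT)
    (posSemidef_mul_inv_mul_transpose B hR')⟩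

/-- Solutions of the inverse problem are the minimizers of the fit. -/
lemma exists_isIOCSolution_iff {n m : ℕ} {A : Matrix (Fin n) (Fin n) ℝ}
    {B : Matrix (Fin n) (Fin m) ℝ} {xT : Fin n → ℝ} {N : ℕ → ℕ} {y : ℕ → ℕ → Fin n → ℝ} {M : ℕ}
    (hM : 0 < M) {Q₀ : Matrix (Fin n) (Fin n) ℝ} {w : ℕ → ℕ → Fin n → ℝ}
    (hy : ∀ j k, 1 ≤ k → k ≤ N j →
      y j k = xT + closedLoop A Q₀ (N j) k *ᵥ (y j 0 - xT) + w j k)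
    (R' : Matrix (Fin m) (Fin m) ℝ) :
    (∃ x l : ℕ → ℕ → Fin n → ℝ, IsIOCSolution A B 1 xT N y M R' x l) ↔
      R'.PosDef ∧ ∀ R'' : Matrix (Fin m) (Fin m) ℝ, R''.PosDef →
        fitCost A Q₀ N (fun j => y j 0 - xT) w M (B * R'⁻¹ * Bᵀ)
          ≤ fitCost A Q₀ N (fun j => y j 0 - xT) w M (B * R''⁻¹ * Bᵀ) := by
  have hM' : 0 < 1 / (M : ℝ) := by positivity
  constructor
  · rintro ⟨x, l, hfeas, hmin⟩
    refine ⟨hfeas.posDef, fun R'' hR'' => ?_⟩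
    obtain ⟨x', l', h'⟩ := exists_isIOCFeasible A B xT N y M hR''
    have h := hmin R'' x' l' h'
    rw [hfeas.iocCost_eq hy, h'.iocCost_eq hy] at h
    exact le_of_mul_le_mul_left h hM'
  · rintro ⟨hR', hmin⟩
    obtain ⟨x, l, hfeas⟩ := exists_isIOCFeasible A B xT N y M hR'
    refine ⟨x, l, hfeas, fun R'' x' l' h' => ?_⟩
    rw [hfeas.iocCost_eq hy, h'.iocCost_eq hy]
    exact mul_le_mul_of_nonneg_left (hmin R'' h'.posDef) hM'.le

/-! ### Consistency -/

/-- Closeness of the inverse weights carries over to the weights. -/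
lemma exists_norm_inv_sub_le_imp_dist_lt {m : ℕ} {R : Matrix (Fin m) (Fin m) ℝ} (hR : R.PosDef)
    {r : ℝ} (hr : 0 < r) :
    ∃ δ > 0, ∀ R' : Matrix (Fin m) (Fin m) ℝ, R'.PosDef → ‖R'⁻¹ - R⁻¹‖ ≤ δ → dist R' R < r := by
  have hinv : ∀ {R' : Matrix (Fin m) (Fin m) ℝ}, R'.PosDef → R'⁻¹⁻¹ = R' := fun h =>
    Matrix.nonsing_inv_nonsing_inv _ ((Matrix.isUnit_iff_isUnit_det _).1 h.isUnit)
  have hcont : ContinuousAt (Inv.inv : Matrix (Fin m) (Fin m) ℝ → _) R⁻¹ := by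
    refine continuousAt_matrix_inv _ ?_
    rw [Ring.inverse_eq_inv']
    exact continuousAt_inv₀ ((Matrix.isUnit_iff_isUnit_det _).1 hR.inv.isUnit).ne_zero
  obtain ⟨δ, hδ, h⟩ := Metric.continuousAt_iff.1 hcont r hr
  refine ⟨δ / 2, by positivity, fun R' hR' hle => ?_⟩
  have h1 := h (x := R'⁻¹) (by rw [dist_eq_norm]; linarith)
  rwa [hinv hR', hinv hR] at h1

theorem theorem2 {n m : ℕ}
    -- the known dynamics
    (A : Matrix (Fin n) (Fin n) ℝ) (B : Matrix (Fin n) (Fin m) ℝ)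
    (hA : IsUnit A) (hAB : IsControllable A B) (hB : B.rank = m)
    -- the target and the true parameter of the forward problem (with `H = I`)
    (xT : Fin n → ℝ) (R : Matrix (Fin m) (Fin m) ℝ) (hR : R.PosDef)
    -- the lengths of the trajectories
    (N : ℕ → ℕ) (hN : ∀ j, 2 * n ≤ N j) (hNbdd : ∃ L : ℕ, ∀ j, N j ≤ L)
    {Ω : Type*} [MeasurableSpace Ω] (μ : Measure Ω) [IsProbabilityMeasure μ]
    -- initial positions (deterministic or random) and optimal inputs of the trajectories
    (xbar : ℕ → Ω → Fin n → ℝ) (hxbar : ∀ j, Measurable (xbar j))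
    (u : ℕ → Ω → ℕ → Fin m → ℝ)
    (hu : ∀ j ω, IsOptimalControl A B 1 R (N j) (xbar j ω - xT) (u j ω))
    -- observation noise: `noise j k` is the noise at step `k` of trajectory `j`
    (noise : ℕ → ℕ → Ω → Fin n → ℝ) (hnoise : ∀ j k, Measurable (noise j k))
    (hnoise_sq : ∀ j k, MemLp (noise j k) 2 μ)
    (hnoise_bdd : ∃ σ : ℝ, ∀ j k, ∫ ω, noise j k ω ⬝ᵥ noise j k ω ∂μ ≤ σ)
    (hnoise_mean : ∀ j k, ∫ ω, noise j k ω ∂μ = 0)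
    (hnoise_indep : iIndepFun (fun (j : ℕ) (ω : Ω) (k : ℕ) => noise j k ω) μ)
    (hnoise_xbar : IndepFun (fun (ω : Ω) (j : ℕ) => xbar j ω)
      (fun (ω : Ω) (j k : ℕ) => noise j k ω) μ)
    -- the recorded outputs, the initial one being free of noise
    (y : ℕ → ℕ → Ω → Fin n → ℝ)
    (hy0 : ∀ j ω, y j 0 ω = xbar j ω)
    (hy : ∀ j k ω, 1 ≤ k → k ≤ N j →
      y j k ω = xT + stateTraj A B (xbar j ω - xT) (u j ω) k + noise j k ω)
    -- the final states keep exciting every direction as the number of trajectories grows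
    (hexc : ∀ᵐ ω ∂μ, ∀ v : Fin n → ℝ, v ≠ 0 →
      Tendsto (fun M : ℕ => ∑ j ∈ Finset.range M,
        (v ⬝ᵥ stateTraj A B (xbar j ω - xT) (u j ω) (N j)) ^ 2) atTop atTop)
    -- the estimator: a solution of the inverse problem whenever this problem has one
    (Rhat : ℕ → Ω → Matrix (Fin m) (Fin m) ℝ)
    (hRhat : ∀ M, n ≤ M → ∀ᵐ ω ∂μ,
      (∃ (R' : Matrix (Fin m) (Fin m) ℝ) (x l : ℕ → ℕ → Fin n → ℝ),
        IsIOCSolution A B 1 xT N (fun j k => y j k ω) M R' x l) →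
      ∃ x l : ℕ → ℕ → Fin n → ℝ,
        IsIOCSolution A B 1 xT N (fun j k => y j k ω) M (Rhat M ω) x l) :
    TendstoInMeasure μ Rhat atTop (fun _ => R) := by
  rcases Nat.eq_zero_or_pos n with rfl | hn
  · -- without states there are no inputs either, and matrices have no entries
    obtain rfl : m = 0 := by
      rw [← hB]
      exact Nat.le_zero.1 (by simpa using B.rank_le_card_height)
    intro ε hε
    have h : ∀ M, {ω | ε ≤ edist (Rhat M ω) R} = ∅ := fun M => by
      refine Set.eq_empty_of_forall_notMem fun ω hω => ?_
      rw [Set.mem_ofPred_eq, Subsingleton.elim (Rhat M ω) R, edist_self] at hω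
      exact hω.not_gt hε
    simp [h]
  obtain ⟨L, hL⟩ := hNbdd
  obtain ⟨σ, hσ⟩ := hnoise_bdd
  have hN2 : ∀ j, 2 ≤ N j := fun j => by linarith [hN j]
  set Q₀ := B * R⁻¹ * Bᵀ with hQ₀
  have htraj : ∀ j ω k, k ≤ N j → stateTraj A B (xbar j ω - xT) (u j ω) k
      = closedLoop A Q₀ (N j) k *ᵥ (xbar j ω - xT) := fun j ω k hk =>
    ((hu j ω).isPMPTrajectory hR).state_eq (posSemidef_mul_inv_mul_transpose B hR) hk
  set X : Ω → ℕ → Fin n → ℝ := fun ω j => xbar j ω - xT with hX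
  have hXmeas : Measurable X := measurable_pi_lambda _ fun j => (hxbar j).sub_const xT
  have hXnoise : IndepFun X (fun (ω : Ω) (j k : ℕ) => noise j k ω) μ :=
    hnoise_xbar.comp (φ := fun f : ℕ → Fin n → ℝ => fun j => f j - xT) (ψ := id)
      (by fun_prop) measurable_id
  have hdata : ∀ ω j k, 1 ≤ k → k ≤ N j → y j k ω
      = xT + closedLoop A Q₀ (N j) k *ᵥ (y j 0 ω - xT) + noise j k ω := fun ω j k h1 h2 => by
    rw [hy j k ω h1 h2, htraj j ω k h2, hy0]
  have hinit : ∀ ω, (fun j => y j 0 ω - xT) = X ω := fun ω => by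
    funext j
    rw [hy0]
  have hexc' : ∀ c : ℝ, Tendsto (fun M : ℕ => μ {ω | ¬ ∀ v : Fin n → ℝ, c * (v ⬝ᵥ v)
      ≤ ∑ j ∈ Finset.range M, (v ⬝ᵥ (closedLoop A Q₀ (N j) (N j) *ᵥ X ω j)) ^ 2})
      atTop (nhds 0) := by
    refine fun c => tendsto_measure_not_excited
      (X := fun j ω => closedLoop A Q₀ (N j) (N j) *ᵥ X ω j) (fun j => ?_) ?_ c
    · have h : Continuous fun v : Fin n → ℝ => closedLoop A Q₀ (N j) (N j) *ᵥ v := by fun_prop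
      exact h.measurable.comp ((hxbar j).sub_const xT)
    · filter_upwards [hexc] with ω hω v hv
      simpa only [htraj _ ω _ le_rfl] using hω v hv
  refine tendstoInMeasure_iff_dist.2 fun r hr => ?_
  obtain ⟨δ₁, hδ₁, hdist⟩ := exists_norm_inv_sub_le_imp_dist_lt hR hr
  obtain ⟨δ₂, hδ₂, hpos⟩ := exists_posDef_of_norm_sub_le hR.inv
  set δ := min δ₁ δ₂ with hδ
  rw [ENNReal.tendsto_nhds_zero]
  intro η hη
  -- a level `d` that the energy exceeds with small probability
  obtain ⟨d, hd, hdη⟩ : ∃ d : ℝ, 0 < d ∧ ENNReal.ofReal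
      (L * (n * (σ * Fintype.card (Fin n × Fin (L + 1)))) / (d / 4)) < η / 2 := by
    have h1 : Tendsto (fun d : ℝ => ENNReal.ofReal
        (L * (n * (σ * Fintype.card (Fin n × Fin (L + 1)))) / (d / 4))) atTop (nhds 0) := by
      rw [← ENNReal.ofReal_zero]
      exact ENNReal.tendsto_ofReal
        ((tendsto_id.atTop_div_const (by norm_num)).const_div_atTop _)
    exact ((eventually_gt_atTop 0).and
      (h1.eventually_lt_const (ENNReal.half_pos hη.ne'))).exists
  obtain ⟨c, hc⟩ := exists_excitation_forall_norm_inv_sub_le A B hB hR hN2 (lt_min hδ₁ hδ₂) hd.le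
  filter_upwards [(hexc' c).eventually_le_const (ENNReal.half_pos hη.ne'),
    eventually_ge_atTop n] with M hMexc hMn
  have henergy := measure_exists_gapEnergy_gt_le A B R hXmeas hnoise hnoise_sq hσ hnoise_mean
    hnoise_indep hXnoise hL M hd
  refine le_trans ?_ ((add_le_add hMexc (henergy.trans hdη.le)).trans (ENNReal.add_halves η).le)
  refine le_trans (measure_mono_ae ?_) (measure_union_le _ _)
  filter_upwards [hRhat M hMn] with ω hsol hω
  by_contra hgood
  change ω ∉ (_ ∪ _ : Set Ω) at hgood
  change ω ∈ {ω | r ≤ dist (Rhat M ω) R} at hω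
  rw [Set.mem_ofPred_eq] at hω
  rw [Set.mem_union, not_or] at hgood
  obtain ⟨hg1, hg2⟩ := hgood
  rw [Set.mem_ofPred_eq, not_not] at hg1
  rw [Set.mem_ofPred_eq] at hg2
  -- on the good event, fitting at least as well as `R` means being close to `R`
  have hclose : ∀ R' : Matrix (Fin m) (Fin m) ℝ, R'.PosDef →
      fitCost A Q₀ N (X ω) (fun j k => noise j k ω) M (B * R'⁻¹ * Bᵀ)
        ≤ fitCost A Q₀ N (X ω) (fun j k => noise j k ω) M Q₀ → ‖R'⁻¹ - R⁻¹‖ ≤ δ :=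
    fun R' hR' hfit => hc (X ω) M hg1 R' hR' (not_lt.1 fun hgt => hg2 ⟨R', hfit, hgt⟩)
  have hiff := exists_isIOCSolution_iff (B := B) (y := fun j k => y j k ω)
    (hn.trans_le hMn) (hdata ω)
  rw [hinit ω] at hiff
  obtain ⟨R', hR'⟩ := exists_posDef_forall_fitCost_le A B hR N (X ω) (fun j k => noise j k ω) M
    (fun P hP hle => hpos P hP (hle.trans (min_le_right _ _))) hclose
  obtain ⟨hRhatPD, hRhatMin⟩ := (hiff _).1 (hsol ⟨R', (hiff R').2 hR'⟩)
  have h1 := hdist _ hRhatPD ((hclose _ hRhatPD (hRhatMin R hR)).trans (min_le_left _ _))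
  exact absurd hω (not_le.2 h1)
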